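/- Let $m\ge 2$ and $n\ge 2$ be integers and let $p_1,\dots,p_m$ be real numbers with $\sum_{j=1}^m p_j=1$ and $np_j\ge 1$ for all $j=1,\dots,m$. Let $(U_1,\dots,U_m)$ be a random vector with the multinomial$(n;p_1,\dots,p_m)$ distribution, that is, the distribution of the numbers of occurrences of the classes $1,\dots,m$ in $n$ independent trials, each of which leads to class $j$ with probability $p_j$. Let $$W=\sum_{j=1}^m\frac{(U_j-np_j)^2}{np_j}$$ be Pearson's statistic. Let $h:[0,\infty)\to\mathbb{R}$ be continuous and five times differentiable on $(0,\infty)$, with $h,h',h'',h^{(3)},h^{(4)},h^{(5)}$ bounded on $(0,\infty)$. Write $\|g\|=\sup_{x>0}|g(x)|$, and let $\chi^2_{(m-1)}h$ denote $\mathbb{E}\,h(Y)$, where $Y$ has the chi-square distribution with $m-1$ degrees of freedom. Then $$\bigl|\mathbb{E}\,h(W)-\chi^2_{(m-1)}h\bigr|\le\frac{4}{(m+1)n}\Bigl(\sum_{j=1}^m\frac1{\sqrt{p_j}}\Bigr)^2\Bigl\{19\|h\|+366\|h'\|+2016\|h''\|+5264\|h^{(3)}\|+106965\|h^{(4)}\|+302922\|h^{(5)}\|\Bigr\}.$$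 -/

import Mathlib

open MeasureTheory ProbabilityTheory Set

noncomputable section

namespace PearsonChiSq

/-- The distribution of the outcome of one trial with `m` classes: class `j` has probability
`p j`. -/
def trialLaw {m : ℕ} (p : Fin m → ℝ) : Measure (Fin m) :=
  ∑ j, ENNReal.ofReal (p j) • Measure.dirac j

/-- The observed counts: `counts x j` is the number of trials `i` whose outcome `x i` is `j`. -/
def counts {n m : ℕ} (x : Fin n → Fin m) : Fin m → ℕ :=
  fun j => (Finset.univ.filter fun i => x i = j).card

/-- The multinomial distribution with parameters `n` and `p`: the law of the vector of observed
counts in `n` independent trials with common distribution `trialLaw p`. -/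
def multinomialLaw {m : ℕ} (n : ℕ) (p : Fin m → ℝ) : Measure (Fin m → ℕ) :=
  (Measure.pi fun _ : Fin n => trialLaw p).map counts

/-- Pearson's statistic of a vector `u` of counts. -/
def pearsonStat {m : ℕ} (n : ℕ) (p : Fin m → ℝ) (u : Fin m → ℕ) : ℝ :=
  ∑ j, ((u j : ℝ) - n * p j) ^ 2 / (n * p j)

/-- The chi-square distribution with `d ≥ 1` degrees of freedom, i.e. the Gamma distribution with
shape `d / 2` and rate `1 / 2`. -/
def chiSquareMeasure (d : ℕ) : Measure ℝ :=
  gammaMeasure ((d : ℝ) / 2) (1 / 2)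

/-- The class `C_b^k(ℝ⁺)`. Only the values of `h` on `[0, ∞)` matter. The function is continuous
on `[0, ∞)`, its derivatives up to order `k` exist on `(0, ∞)`, and `h` and these derivatives are
bounded there. Nothing is asked of the one-sided derivatives at `0`; a function with bounded
one-sided derivatives up to order `k ≥ 1` on all of `[0, ∞)` belongs to the class. -/
structure MemCb (k : ℕ) (h : ℝ → ℝ) : Prop where
  continuousOn : ContinuousOn h (Ici 0)
  differentiableOn : ∀ i < k, DifferentiableOn ℝ (iteratedDeriv i h) (Ioi 0)
  bounded : ∀ i ≤ k, ∃ C : ℝ, ∀ x : ℝ, 0 < x → |iteratedDeriv i h x| ≤ C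

/-- The norm `‖f‖ = sup_{x > 0} |f x|`. -/
def supNorm (f : ℝ → ℝ) : ℝ :=
  ⨆ x : Ioi (0 : ℝ), |f x|

end PearsonChiSq

end

/-! The proof is Stein's method for the chi-square law with `d = m - 1`, applied to `W = |S|²`,
where `S` is the standardized count vector, viewed as a random walk of `n` independent steps. One
solves `x φ' + (d - x)/2 φ = h - χ²h` and estimates the expectation of the left side at `W`.

Analytic half. The `k`-th derivative `G_k` of the solution satisfies the same kind of equation with
`d + 2k` in place of `d` and right side `H_k = h⁽ᵏ⁾ + (k/2) G_{k-1}` for `k ≥ 1`. Read as a second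
order equation for `G_{k-1}`, it obeys a maximum principle, so `|H_k| ≤ 2‖h⁽ᵏ⁾‖`. Comparison with
the gamma weight bounds `(d + 2k - x) G_k`, hence also `x G_{k+1}`. Using the first estimate near
`0` and the second away from `0` gives bounds of order `1/(d + 2)`, the source of the factor `4/(m +
1)` (`steinPair_bounds`, `MemCb.exists_stein_solution`).

Probabilistic half. Write `c_k = 1/√(n p_k)`. A step into class `k` changes `|S|²` by `2 c_k s_k +
β_k` with `β_k = c_k² - 1/n`. Exchangeability of the steps turns `E |S|² φ(|S|²)` into an average
over one last step added to a walk of `n - 1` steps. In its Taylor expansion the zeroth order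
averages to `0`, and the first order gives `(m - 1) φ + 2 W φ'`, which cancels in the Stein operator
up to the effect of one step. The remainder has size `∑ c_k²`. The second order term is only of size
`c_k` times the expectation of an odd function of `S`. That expectation is itself small: reversing
the steps one at a time carries `S` to `-S`, and each reversal costs only a third order term, since
the first order averages out and the second cancels (`walkE_eq_half_of_odd`, `abs_walk_odd_le`).
Everything is thus at most a constant times `(∑ c_k)² = (∑ p_k^{-1/2})²/n`. Moments of the
coordinates come from an exponential moment bound. -/

noncomputable section

namespace PearsonChiSq

/-! ### Maximum principle and first order comparison estimates -/

open Filter Topology in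
/-- A maximum principle for the operator `x u'' + (D - x) / 2 u' - κ / 2 u` on `(0, ∞)`. -/
theorem half_mul_le_of_laguerre {u u₁ u₂ r : ℝ → ℝ} {D κ B M : ℝ} (hD : 2 ≤ D) (hκ : 0 < κ)
    (hu : ∀ x, 0 < x → HasDerivAt u (u₁ x) x) (hu₁ : ∀ x, 0 < x → HasDerivAt u₁ (u₂ x) x)
    (hB : ∀ x, 0 < x → |u x| ≤ B)
    (heq : ∀ x, 0 < x → x * u₂ x + (D - x) / 2 * u₁ x = r x + κ / 2 * u x)
    (hr : ∀ x, 0 < x → |r x| ≤ M) {x₁ : ℝ} (hx₁ : 0 < x₁) : κ / 2 * u x₁ ≤ M := by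
  -- This barrier tends to infinity at both ends of `(0, ∞)`, so `u - ε ψ` attains an interior
  -- maximum; its contribution disappears as `ε → 0`.
  set ψ : ℝ → ℝ := fun x => x - Real.log x with hψ
  have hψ0 : ∀ x, 0 < x → 0 ≤ ψ x := fun x hx => by
    have := Real.log_le_sub_one_of_pos hx
    simp only [hψ]; linarith
  have key : ∀ ε : ℝ, 0 < ε → κ / 2 * u x₁ ≤ M + ε * ((D + 1) / 2 + κ / 2 * ψ x₁) := by
    intro ε hε
    set v : ℝ → ℝ := fun x => u x - ε * ψ x with hv
    set v₁ : ℝ → ℝ := fun x => u₁ x - ε * (1 - x⁻¹) with hv₁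
    have dv : ∀ x, 0 < x → HasDerivAt v (v₁ x) x := fun x hx =>
      (hu x hx).sub (((hasDerivAt_id x).sub (Real.hasDerivAt_log hx.ne')).const_mul ε)
    have dv₁ : ∀ x, 0 < x → HasDerivAt v₁ (u₂ x - ε * (x ^ 2)⁻¹) x := fun x hx => by
      have := (hu₁ x hx).sub (((hasDerivAt_const x (1 : ℝ)).sub (hasDerivAt_inv hx.ne')).const_mul ε)
      exact this.congr_deriv (by ring)
    obtain ⟨C, hC⟩ : ∃ C, ψ x₁ + 2 * B / ε < C := ⟨_, lt_add_one _⟩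
    have hfar : ∀ x, 0 < x → C ≤ ψ x → v x < v x₁ := by
      intro x hx hCx
      have h1 := abs_le.1 (hB x hx)
      have h2 := abs_le.1 (hB x₁ hx₁)
      have h3 : ε * (ψ x₁ + 2 * B / ε) < ε * ψ x := by gcongr; linarith
      have h4 : ε * (ψ x₁ + 2 * B / ε) = ε * ψ x₁ + 2 * B := by field_simp
      simp only [hv]; linarith
    have htop : Tendsto ψ atTop atTop := by
      have h1 : Tendsto (fun x : ℝ => x / 2) atTop atTop := tendsto_id.atTop_div_const (by norm_num)
      refine tendsto_atTop_mono' _ ?_ h1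
      have := Real.isLittleO_log_id_atTop.bound (show (0 : ℝ) < 1 / 2 by norm_num)
      filter_upwards [this, eventually_gt_atTop 0] with x hx hx0
      simp only [id, Real.norm_eq_abs, abs_of_pos hx0] at hx
      have := le_abs_self (Real.log x)
      simp only [hψ]; linarith
    have hzero : Tendsto ψ (𝓝[>] 0) atTop := by
      have h1 : Tendsto (fun x : ℝ => -Real.log x) (𝓝[>] 0) atTop :=
        tendsto_neg_atBot_atTop.comp Real.tendsto_log_nhdsGT_zero
      refine tendsto_atTop_mono' _ ?_ h1
      filter_upwards [self_mem_nhdsWithin] with x hx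
      simp only [hψ]; linarith [mem_Ioi.1 hx]
    obtain ⟨b, hbC, hbx⟩ := ((htop.eventually_ge_atTop C).and (eventually_gt_atTop x₁)).exists
    obtain ⟨a, haC, ha⟩ := ((hzero.eventually_ge_atTop C).and (Ioo_mem_nhdsGT hx₁)).exists
    have hpos : ∀ x ∈ Icc a b, 0 < x := fun x hx => ha.1.trans_le hx.1
    obtain ⟨x₀, hx₀, hmax⟩ := isCompact_Icc.exists_isMaxOn (f := v)
      (nonempty_Icc.2 (ha.2.le.trans hbx.le))
      (fun x hx => (dv x (hpos x hx)).continuousAt.continuousWithinAt)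
    have hx₀0 := hpos x₀ hx₀
    have hge : v x₁ ≤ v x₀ := hmax ⟨ha.2.le, hbx.le⟩
    have hxa : a < x₀ := lt_of_le_of_ne hx₀.1 (by
      rintro rfl; exact absurd (hfar _ ha.1 haC) (not_lt.2 hge))
    have hxb : x₀ < b := lt_of_le_of_ne hx₀.2 (by
      rintro rfl; exact absurd (hfar _ hx₀0 hbC) (not_lt.2 hge))
    have hloc : IsLocalMax v x₀ := hmax.isLocalMax (Icc_mem_nhds hxa hxb)
    have hv0 : v₁ x₀ = 0 := hloc.hasDerivAt_eq_zero (dv x₀ hx₀0)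
    have hderiv : deriv v =ᶠ[𝓝 x₀] v₁ := by
      filter_upwards [Ioi_mem_nhds hx₀0] with x hx using (dv x hx).deriv
    have hdd : deriv (deriv v) x₀ = u₂ x₀ - ε * (x₀ ^ 2)⁻¹ := by
      rw [hderiv.deriv_eq, (dv₁ x₀ hx₀0).deriv]
    -- A positive second derivative would make `x₀` a local minimum as well, so `v` would be locally
    -- constant with second derivative zero.
    have hneg : u₂ x₀ - ε * (x₀ ^ 2)⁻¹ ≤ 0 := by
      by_contra hcon
      push Not at hcon
      have hmin : IsLocalMin v x₀ := isLocalMin_of_deriv_deriv_pos (by rw [hdd]; exact hcon)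
        (by rw [(dv x₀ hx₀0).deriv, hv0]) (dv x₀ hx₀0).continuousAt
      have hconst : v =ᶠ[𝓝 x₀] fun _ => v x₀ := by
        filter_upwards [hloc, hmin] with x h1 h2 using le_antisymm h1 h2
      have : deriv (deriv v) x₀ = 0 := by
        rw [hconst.deriv.deriv_eq]; simp
      rw [hdd] at this
      linarith
    have e1 := heq x₀ hx₀0
    have e2 := (abs_le.1 (hr x₀ hx₀0)).1
    have hu1 : u₁ x₀ = ε * (1 - x₀⁻¹) := by simp only [hv₁] at hv0; linarith
    have e3 : x₀ * u₂ x₀ ≤ ε * x₀⁻¹ := by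
      have : x₀ * (u₂ x₀ - ε * (x₀ ^ 2)⁻¹) ≤ 0 := mul_nonpos_of_nonneg_of_nonpos hx₀0.le hneg
      have e : x₀ * (ε * (x₀ ^ 2)⁻¹) = ε * x₀⁻¹ := by field_simp
      linarith
    -- This is where `2 ≤ D` enters: the drift of the barrier must dominate its second order term as
    -- `x₀ → 0`.
    have e4 : (D - x₀) / 2 * u₁ x₀ + ε * x₀⁻¹ ≤ ε * ((D + 1) / 2) := by
      rw [hu1]
      have : ε * ((D + 1) / 2) - ((D - x₀) / 2 * (ε * (1 - x₀⁻¹)) + ε * x₀⁻¹)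
          = ε * (x₀ / 2 + (D - 2) / 2 * x₀⁻¹) := by field_simp; ring
      have : 0 ≤ ε * (x₀ / 2 + (D - 2) / 2 * x₀⁻¹) := by
        have := inv_pos.2 hx₀0
        have : 0 ≤ (D - 2) / 2 := by linarith
        positivity
      linarith
    have e5 : κ / 2 * u x₀ ≤ M + ε * ((D + 1) / 2) := by linarith
    have e6 : κ / 2 * v x₁ ≤ κ / 2 * v x₀ := by gcongr
    have e7 : 0 ≤ κ / 2 * (ε * ψ x₀) := by have := hψ0 x₀ hx₀0; positivity
    simp only [hv] at e6
    nlinarith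
  refine le_of_forall_pos_le_add fun δ hδ => ?_
  set K := (D + 1) / 2 + κ / 2 * ψ x₁ with hK
  have hK0 : 0 < K := by have := hψ0 x₁ hx₁; positivity
  have := key (δ / K) (by positivity)
  rwa [div_mul_cancel₀ _ hK0.ne'] at this

theorem half_mul_abs_le_of_laguerre {u u₁ u₂ r : ℝ → ℝ} {D κ B M : ℝ} (hD : 2 ≤ D) (hκ : 0 < κ)
    (hu : ∀ x, 0 < x → HasDerivAt u (u₁ x) x) (hu₁ : ∀ x, 0 < x → HasDerivAt u₁ (u₂ x) x)
    (hB : ∀ x, 0 < x → |u x| ≤ B)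
    (heq : ∀ x, 0 < x → x * u₂ x + (D - x) / 2 * u₁ x = r x + κ / 2 * u x)
    (hr : ∀ x, 0 < x → |r x| ≤ M) {x : ℝ} (hx : 0 < x) : κ / 2 * |u x| ≤ M := by
  have h1 := half_mul_le_of_laguerre hD hκ hu hu₁ hB heq hr hx
  have h2 := half_mul_le_of_laguerre (u := fun x => -u x) (u₁ := fun x => -u₁ x)
    (u₂ := fun x => -u₂ x) (r := fun x => -r x) hD hκ (fun x hx => (hu x hx).neg)
    (fun x hx => (hu₁ x hx).neg) (fun x hx => by rw [abs_neg]; exact hB x hx)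
    (fun x hx => by linarith [heq x hx]) (fun x hx => by rw [abs_neg]; exact hr x hx) hx
  rcases abs_cases (u x) with ⟨h, _⟩ | ⟨h, _⟩ <;> rw [h] <;> linarith

/-- The derivative of `x ^ (D / 2) * exp (-x / 2) * G x`. -/
theorem hasDerivAt_gammaWeight_mul {D x y : ℝ} {G : ℝ → ℝ} (hx : 0 < x) (hG : HasDerivAt G y x) :
    HasDerivAt (fun x => x ^ (D / 2) * Real.exp (-x / 2) * G x)
      (x ^ (D / 2 - 1) * Real.exp (-x / 2) * (x * y + (D - x) / 2 * G x)) x := by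
  have h1 := Real.hasDerivAt_rpow_const (p := D / 2) (Or.inl hx.ne')
  have h2 : HasDerivAt (fun x : ℝ => Real.exp (-x / 2)) (Real.exp (-x / 2) * (-1 / 2)) x :=
    ((hasDerivAt_id x).neg.div_const 2).exp
  have h3 := (h1.mul h2).mul hG
  refine h3.congr_deriv ?_
  have : x ^ (D / 2) = x ^ (D / 2 - 1) * x := by
    rw [← Real.rpow_add_one hx.ne']; ring_nf
  simp only [Pi.mul_apply, this]
  ring

open Filter Topology in
/-- Bounds for the solution of a first order equation, to the left of `D`. -/
theorem abs_le_of_stein_left {D M x₀ : ℝ} {G G₁ : ℝ → ℝ} (hG : ∀ x, 0 < x → HasDerivAt G (G₁ x) x)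
    (hM : ∀ x, 0 < x → |x * G₁ x + (D - x) / 2 * G x| ≤ M)
    (hlim : Tendsto (fun x => x ^ (D / 2) * Real.exp (-x / 2) * G x) (𝓝[>] 0) (𝓝 0))
    (hx₀ : 0 < x₀) (hx₀D : x₀ < D) : (D - x₀) * G x₀ ≤ 2 * M := by
  have hD : 0 < D := hx₀.trans hx₀D
  -- The constant function `K` is a supersolution on `(0, x₀]`, so the weighted difference `K - G`
  -- increases from its limit `0` at the origin.
  set K := 2 * M / (D - x₀) with hK
  have hM0 : 0 ≤ M := (abs_nonneg _).trans (hM x₀ hx₀)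
  have hd : 0 < D - x₀ := by linarith
  have hK0 : 0 ≤ K := by positivity
  set B : ℝ → ℝ := fun x => x ^ (D / 2) * Real.exp (-x / 2) * (K - G x) with hB
  have dB : ∀ x, 0 < x → HasDerivAt B _ x := fun x hx =>
    hasDerivAt_gammaWeight_mul (D := D) hx ((hasDerivAt_const x K).sub (hG x hx))
  have hmono : MonotoneOn B (Ioc 0 x₀) := by
    apply monotoneOn_of_deriv_nonneg (convex_Ioc 0 x₀)
      (fun x hx => (dB x hx.1).continuousAt.continuousWithinAt)
    · rw [interior_Ioc]
      exact fun x hx => (dB x hx.1).differentiableAt.differentiableWithinAt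
    · rw [interior_Ioc]
      intro x hx
      rw [(dB x hx.1).deriv]
      have hx0 := hx.1
      refine mul_nonneg (by positivity) ?_
      have h1 := (abs_le.1 (hM x hx0)).2
      have h2 : (D - x₀) / 2 * K = M := by rw [hK]; field_simp
      have h3 : (D - x₀) / 2 * K ≤ (D - x) / 2 * K := by gcongr; exact hx.2.le
      simp only [zero_sub]
      nlinarith
  have hlimB : Tendsto B (𝓝[>] 0) (𝓝 0) := by
    have h1 : Tendsto (fun x : ℝ => x ^ (D / 2) * Real.exp (-x / 2) * K) (𝓝[>] 0) (𝓝 0) := by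
      have : ContinuousAt (fun x : ℝ => x ^ (D / 2) * Real.exp (-x / 2) * K) 0 :=
        ((Real.continuousAt_rpow_const _ _ (Or.inr (by positivity))).mul
          (by fun_prop)).mul continuousAt_const
      have h := this.tendsto.mono_left (nhdsWithin_le_nhds (s := Ioi 0))
      simpa [Real.zero_rpow (by positivity : D / 2 ≠ 0)] using h
    have := h1.sub hlim
    simp only [sub_zero] at this
    refine this.congr fun x => ?_
    simp only [hB]; ring
  have hBx : 0 ≤ B x₀ := by
    refine le_of_tendsto hlimB ?_
    filter_upwards [Ioo_mem_nhdsGT hx₀] with x hx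
    exact hmono ⟨hx.1, hx.2.le⟩ ⟨hx₀, le_rfl⟩ hx.2.le
  have hw : 0 < x₀ ^ (D / 2) * Real.exp (-x₀ / 2) := by positivity
  have := nonneg_of_mul_nonneg_right hBx hw
  have h2 : (D - x₀) * K = 2 * M := by rw [hK]; field_simp
  nlinarith

open Filter Topology in
theorem tendsto_gammaWeight_atTop (a : ℝ) :
    Tendsto (fun x : ℝ => x ^ a * Real.exp (-x / 2)) atTop (𝓝 0) := by
  have := tendsto_rpow_mul_exp_neg_mul_atTop_nhds_zero a (1 / 2) (by norm_num)
  refine this.congr fun x => ?_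
  congr 2; ring

open Filter Topology in
/-- Bounds for the solution of a first order equation, to the right of `D`. -/
theorem abs_le_of_stein_right {D M x₀ : ℝ} {G G₁ : ℝ → ℝ}
    (hG : ∀ x, 0 < x → HasDerivAt G (G₁ x) x)
    (hM : ∀ x, 0 < x → |x * G₁ x + (D - x) / 2 * G x| ≤ M)
    (hlim : Tendsto (fun x => x ^ (D / 2) * Real.exp (-x / 2) * G x) atTop (𝓝 0))
    (hx₀ : 0 < x₀) (hx₀D : D < x₀) : (x₀ - D) * G x₀ ≤ 2 * M := by
  set K := 2 * M / (x₀ - D) with hK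
  have hM0 : 0 ≤ M := (abs_nonneg _).trans (hM x₀ hx₀)
  have hd : 0 < x₀ - D := by linarith
  have hK0 : 0 ≤ K := by positivity
  set B : ℝ → ℝ := fun x => x ^ (D / 2) * Real.exp (-x / 2) * (K - G x) with hB
  have dB : ∀ x, 0 < x → HasDerivAt B _ x := fun x hx =>
    hasDerivAt_gammaWeight_mul (D := D) hx ((hasDerivAt_const x K).sub (hG x hx))
  have hanti : AntitoneOn B (Ici x₀) := by
    apply antitoneOn_of_deriv_nonpos (convex_Ici x₀)
      (fun x hx => (dB x (hx₀.trans_le hx)).continuousAt.continuousWithinAt)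
    · rw [interior_Ici]
      exact fun x hx => (dB x (hx₀.trans hx)).differentiableAt.differentiableWithinAt
    · rw [interior_Ici]
      intro x hx
      have hx0 : 0 < x := hx₀.trans hx
      rw [(dB x hx0).deriv]
      refine mul_nonpos_of_nonneg_of_nonpos (by positivity) ?_
      have h1 := (abs_le.1 (hM x hx0)).1
      have h2 : (x₀ - D) / 2 * K = M := by rw [hK]; field_simp
      have h3 : (x₀ - D) / 2 * K ≤ (x - D) / 2 * K := by gcongr; exact (mem_Ioi.1 hx).le
      simp only [zero_sub]
      nlinarith
  have hlimB : Tendsto B atTop (𝓝 0) := by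
    have h1 := (tendsto_gammaWeight_atTop (D / 2)).mul_const K
    have := h1.sub hlim
    simp only [sub_zero, zero_mul] at this
    refine this.congr fun x => ?_
    simp only [hB]; ring
  have hBx : 0 ≤ B x₀ := by
    refine le_of_tendsto hlimB ?_
    filter_upwards [eventually_ge_atTop x₀] with x hx
    exact hanti self_mem_Ici hx hx
  have hw : 0 < x₀ ^ (D / 2) * Real.exp (-x₀ / 2) := by positivity
  have := nonneg_of_mul_nonneg_right hBx hw
  have h2 : (x₀ - D) * K = 2 * M := by rw [hK]; field_simp
  nlinarith

open Filter Topology in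
theorem abs_sub_mul_le_of_stein {D M x₀ : ℝ} {G G₁ : ℝ → ℝ}
    (hG : ∀ x, 0 < x → HasDerivAt G (G₁ x) x)
    (hM : ∀ x, 0 < x → |x * G₁ x + (D - x) / 2 * G x| ≤ M)
    (hlim0 : Tendsto (fun x => x ^ (D / 2) * Real.exp (-x / 2) * G x) (𝓝[>] 0) (𝓝 0))
    (hlim : Tendsto (fun x => x ^ (D / 2) * Real.exp (-x / 2) * G x) atTop (𝓝 0))
    (hx₀ : 0 < x₀) : |(D - x₀) * G x₀| ≤ 2 * M := by
  have hM0 : 0 ≤ M := (abs_nonneg _).trans (hM x₀ hx₀)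
  have hG' : ∀ x, 0 < x → HasDerivAt (fun x => -G x) (-G₁ x) x := fun x hx => (hG x hx).neg
  have hM' : ∀ x, 0 < x → |x * -G₁ x + (D - x) / 2 * -G x| ≤ M := fun x hx => by
    rw [← abs_neg]; convert hM x hx using 2; ring
  have n0 : Tendsto (fun x => x ^ (D / 2) * Real.exp (-x / 2) * -G x) (𝓝[>] 0) (𝓝 0) := by
    simpa using hlim0.neg
  have n1 : Tendsto (fun x => x ^ (D / 2) * Real.exp (-x / 2) * -G x) atTop (𝓝 0) := by
    simpa using hlim.neg
  rcases lt_trichotomy x₀ D with h | h | h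
  · have h1 := abs_le_of_stein_left hG hM hlim0 hx₀ h
    have h2 := abs_le_of_stein_left hG' hM' n0 hx₀ h
    rw [abs_le]; constructor <;> linarith
  · simp only [h, sub_self, zero_mul, abs_zero]; linarith
  · have h1 := abs_le_of_stein_right hG hM hlim hx₀ h
    have h2 := abs_le_of_stein_right hG' hM' n1 hx₀ h
    rw [abs_le]; constructor <;> linarith

open Filter Topology in
-- One factor `x` of the weight is absorbed by `G`, and the exponent `D / 2 - 1` left over is
-- positive. This supplies the boundary conditions for the higher derivatives.
theorem tendsto_gammaWeight_mul_of_abs_le {D C : ℝ} {G : ℝ → ℝ} (hD : 2 < D)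
    (hC : ∀ x, 0 < x → |x * G x| ≤ C) :
    Tendsto (fun x => x ^ (D / 2) * Real.exp (-x / 2) * G x) (𝓝[>] 0) (𝓝 0) ∧
    Tendsto (fun x => x ^ (D / 2) * Real.exp (-x / 2) * G x) atTop (𝓝 0) := by
  have hb : ∀ x, 0 < x → ‖x ^ (D / 2) * Real.exp (-x / 2) * G x‖
      ≤ x ^ (D / 2 - 1) * Real.exp (-x / 2) * C := by
    intro x hx
    have : x ^ (D / 2) = x ^ (D / 2 - 1) * x := by
      rw [← Real.rpow_add_one hx.ne', sub_add_cancel]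
    have e : x ^ (D / 2) * Real.exp (-x / 2) * G x
        = x ^ (D / 2 - 1) * Real.exp (-x / 2) * (x * G x) := by rw [this]; ring
    rw [e, norm_mul, Real.norm_of_nonneg (by positivity)]
    gcongr
    exact hC x hx
  constructor
  · refine squeeze_zero_norm' (by filter_upwards [self_mem_nhdsWithin] with x hx using hb x hx) ?_
    have : ContinuousAt (fun x : ℝ => x ^ (D / 2 - 1) * Real.exp (-x / 2) * C) 0 :=
      ((Real.continuousAt_rpow_const _ _ (Or.inr (by linarith))).mul
        (by fun_prop)).mul continuousAt_const
    have h := this.tendsto.mono_left (nhdsWithin_le_nhds (s := Ioi 0))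
    simpa [Real.zero_rpow (by linarith : D / 2 - 1 ≠ 0)] using h
  · refine squeeze_zero_norm' (by filter_upwards [eventually_gt_atTop 0] with x hx using hb x hx) ?_
    simpa using (tendsto_gammaWeight_atTop (D / 2 - 1)).mul_const C

/-! ### Derivatives of the Stein solution -/

/-- The successive derivatives `G_k` of a solution `G` of the Stein equation
`x G' + (d - x) / 2 G = q 0`, paired with the right hand sides of the equations
`x G_k' + (d + 2 k - x) / 2 G_k = H_k` which they satisfy; here `q k` is the `k`-th derivative
of `q 0`. -/
def steinPair (d : ℝ) (q : ℕ → ℝ → ℝ) (G : ℝ → ℝ) : ℕ → (ℝ → ℝ) × (ℝ → ℝ)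
  | 0 => (G, q 0)
  | k + 1 => (fun x => ((steinPair d q G k).2 x
      - (d + 2 * k - x) / 2 * (steinPair d q G k).1 x) / x,
      fun x => q (k + 1) x + ((k : ℝ) + 1) / 2 * (steinPair d q G k).1 x)

section

variable {d : ℝ} {q : ℕ → ℝ → ℝ} {G : ℝ → ℝ}

theorem steinPair_equation (k : ℕ) {x : ℝ} (hx : 0 < x) :
    x * (steinPair d q G (k + 1)).1 x + (d + 2 * k - x) / 2 * (steinPair d q G k).1 x
      = (steinPair d q G k).2 x := by
  simp only [steinPair]
  field_simp
  ring

/-- Differentiating the `k`-th equation raises `d + 2k` by `2` and moves `G_k / 2` to the right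
side, which is why `H_{k+1} = H_k' + G_k / 2`. -/
theorem hasDerivAt_steinPair {n : ℕ}
    (hq : ∀ k < n, ∀ x, 0 < x → HasDerivAt (q k) (q (k + 1) x) x)
    (hG : ∀ x, 0 < x → HasDerivAt G ((steinPair d q G 1).1 x) x) (k : ℕ) :
    (k ≤ n → ∀ x, 0 < x →
      HasDerivAt (steinPair d q G k).1 ((steinPair d q G (k + 1)).1 x) x) ∧
    (k < n → ∀ x, 0 < x → HasDerivAt (steinPair d q G k).2
      ((steinPair d q G (k + 1)).2 x - (steinPair d q G k).1 x / 2) x) := by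
  induction k with
  | zero =>
    refine ⟨fun _ => hG, fun hk x hx => (hq 0 hk x hx).congr_deriv ?_⟩
    simp only [steinPair]; push_cast; ring
  | succ k ih =>
    refine ⟨fun hk x hx => ?_, fun hk x hx => ?_⟩
    · have h1 := ih.1 (by omega) x hx
      have h2 := ih.2 (by omega) x hx
      have h3 := (h2.sub ((((hasDerivAt_id x).const_sub (d + 2 * k)).div_const 2).mul h1)).div
        (hasDerivAt_id x) hx.ne'
      refine h3.congr_deriv ?_
      have e1 := steinPair_equation (d := d) (q := q) (G := G) k hx
      have e2 := steinPair_equation (d := d) (q := q) (G := G) (k + 1) hx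
      push_cast at e2
      simp only [id, Pi.mul_apply, Pi.sub_apply]
      rw [← e1, ← e2]
      field_simp
      ring
    · have h1 := ih.1 (by omega) x hx
      have h3 := (hq (k + 1) hk x hx).add (h1.const_mul (((k : ℝ) + 1) / 2))
      refine h3.congr_deriv ?_
      simp only [steinPair]; push_cast; ring

open Filter Topology in
-- The four estimates sustain each other in the induction: boundedness of `G_k` admits the maximum
-- principle for `H_{k+1}`, and the bound on `x G_{k+1}` gives the boundary limits needed for the
-- first order comparison.
theorem steinPair_bounds {n : ℕ} {N : ℕ → ℝ} (hd : 1 ≤ d)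
    (hq : ∀ k < n, ∀ x, 0 < x → HasDerivAt (q k) (q (k + 1) x) x)
    (hN : ∀ k ≤ n, ∀ x, 0 < x → |q k x| ≤ N k)
    (hG : ∀ x, 0 < x → HasDerivAt G ((steinPair d q G 1).1 x) x)
    (hlim0 : Tendsto (fun x => x ^ (d / 2) * Real.exp (-x / 2) * G x) (𝓝[>] 0) (𝓝 0))
    (hlim : Tendsto (fun x => x ^ (d / 2) * Real.exp (-x / 2) * G x) atTop (𝓝 0))
    (k : ℕ) (hk : k ≤ n) :
    (∃ B, ∀ x, 0 < x → |(steinPair d q G k).1 x| ≤ B) ∧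
    (∀ x, 0 < x → |(steinPair d q G k).2 x| ≤ (if k = 0 then 1 else 2) * N k) ∧
    (∀ x, 0 < x → |(d + 2 * k - x) * (steinPair d q G k).1 x|
      ≤ 2 * ((if k = 0 then 1 else 2) * N k)) ∧
    (∀ x, 0 < x → |x * (steinPair d q G (k + 1)).1 x|
      ≤ 2 * ((if k = 0 then 1 else 2) * N k)) := by
  have main : ∀ (k : ℕ) (M : ℝ), k ≤ n → (∀ x, 0 < x → |(steinPair d q G k).2 x| ≤ M) →
      Tendsto (fun x => x ^ ((d + 2 * k) / 2) * Real.exp (-x / 2) * (steinPair d q G k).1 x)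
        (𝓝[>] 0) (𝓝 0) →
      Tendsto (fun x => x ^ ((d + 2 * k) / 2) * Real.exp (-x / 2) * (steinPair d q G k).1 x)
        atTop (𝓝 0) →
      (∃ B, ∀ x, 0 < x → |(steinPair d q G k).1 x| ≤ B) ∧
      (∀ x, 0 < x → |(d + 2 * k - x) * (steinPair d q G k).1 x| ≤ 2 * M) ∧
      (∀ x, 0 < x → |x * (steinPair d q G (k + 1)).1 x| ≤ 2 * M) := by
    intro k M hk hM l0 l1
    have hder := (hasDerivAt_steinPair hq hG k).1 hk
    have hb : ∀ x, 0 < x → |(d + 2 * k - x) * (steinPair d q G k).1 x| ≤ 2 * M := fun x hx =>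
      abs_sub_mul_le_of_stein hder
        (fun y hy => by rw [steinPair_equation k hy]; exact hM y hy) l0 l1 hx
    refine ⟨?_, hb, fun x hx => ?_⟩
    -- Only finiteness matters here. Compactness covers the range where `D - x` may vanish;
    -- elsewhere `|D - x| ≥ D / 2`.
    · set D := d + 2 * (k : ℝ) with hDdef
      have hD : 0 < D := by positivity
      obtain ⟨B, hB⟩ := isCompact_Icc.exists_bound_of_continuousOn
        (s := Icc (D / 2) (2 * D)) (f := (steinPair d q G k).1)
        (fun x hx => (hder x (by linarith [hx.1])).continuousAt.continuousWithinAt)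
      refine ⟨max B (4 * M / D), fun x hx => ?_⟩
      by_cases hx1 : x ∈ Icc (D / 2) (2 * D)
      · exact (hB x hx1).trans (le_max_left _ _)
      · refine le_trans ?_ (le_max_right _ _)
        have h1 := hb x hx
        rw [abs_mul] at h1
        have h2 : D / 2 ≤ |D - x| := by
          rw [mem_Icc, not_and_or, not_le, not_le] at hx1
          rcases hx1 with h | h
          · rw [abs_of_pos (by linarith)]; linarith
          · rw [abs_of_neg (by linarith)]; linarith
        rw [le_div_iff₀ hD]
        nlinarith [abs_nonneg ((steinPair d q G k).1 x)]
    · have e1 := steinPair_equation (d := d) (q := q) (G := G) k hx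
      have h1 := abs_le.1 (hb x hx)
      have h2 := abs_le.1 (hM x hx)
      rw [abs_le]
      constructor <;> nlinarith
  induction k with
  | zero =>
    have h0 : ∀ x, 0 < x → |(steinPair d q G 0).2 x| ≤ N 0 := hN 0 hk
    have := main 0 (N 0) hk h0 (by simpa [steinPair] using hlim0) (by simpa [steinPair] using hlim)
    simp only [if_true, one_mul]
    exact ⟨this.1, h0, this.2⟩
  | succ k ih =>
    obtain ⟨⟨B, hB⟩, hH, hb, hx1⟩ := ih (by omega)
    have h0 : ∀ x, 0 < x → |(steinPair d q G (k + 1)).2 x| ≤ 2 * N (k + 1) := by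
      intro x hx
      -- The equation of index `k + 1` is read as a second order equation for `G_k`, with zeroth
      -- order coefficient `-(k + 1) / 2`.
      have h1 := half_mul_abs_le_of_laguerre (D := d + 2 * ((k + 1 : ℕ) : ℝ))
        (κ := (k : ℝ) + 1) (r := q (k + 1)) (M := N (k + 1))
        (by push_cast; linarith [(Nat.cast_nonneg k : (0 : ℝ) ≤ k)]) (by positivity)
        ((hasDerivAt_steinPair hq hG k).1 (by omega))
        ((hasDerivAt_steinPair hq hG (k + 1)).1 hk) hB
        (fun y hy => steinPair_equation (k + 1) hy) (hN (k + 1) hk) hx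
      have h2 := hN (k + 1) hk x hx
      calc |(steinPair d q G (k + 1)).2 x|
          = |q (k + 1) x + ((k : ℝ) + 1) / 2 * (steinPair d q G k).1 x| := rfl
        _ ≤ |q (k + 1) x| + |((k : ℝ) + 1) / 2 * (steinPair d q G k).1 x| := abs_add_le _ _
        _ = |q (k + 1) x| + ((k : ℝ) + 1) / 2 * |(steinPair d q G k).1 x| := by
          rw [abs_mul, abs_of_pos (by positivity : (0 : ℝ) < ((k : ℝ) + 1) / 2)]
        _ ≤ 2 * N (k + 1) := by linarith
    have hl := tendsto_gammaWeight_mul_of_abs_le (D := d + 2 * ((k + 1 : ℕ) : ℝ))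
      (by push_cast; linarith [(Nat.cast_nonneg k : (0 : ℝ) ≤ k)]) hx1
    have := main (k + 1) _ hk h0 hl.1 hl.2
    simp only [Nat.succ_ne_zero, if_false]
    exact ⟨this.1, h0, this.2⟩

/-- For `x ≥ D / 2` the first hypothesis is efficient, for `x ≤ D / 2` the second, since then `D + 2
- x ≥ (D + 4) / 2`. -/
theorem abs_le_of_abs_mul_le {c D x N₀ N₁ g : ℝ} (hD : 0 < D)
    (hx : 0 < x) (hN0 : 0 ≤ N₀) (hN1 : 0 ≤ N₁) (h1 : |x * g| ≤ 2 * (c * N₀))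
    (h2 : |(D + 2 - x) * g| ≤ 4 * N₁) (hc : 0 ≤ c) :
    |g| ≤ 4 * c / D * N₀ + 8 / (D + 4) * N₁ := by
  rw [abs_mul] at h1 h2
  rcases le_total (D / 2) x with h | h
  · rw [abs_of_pos hx] at h1
    have : |g| ≤ 4 * c / D * N₀ := by
      rw [div_mul_eq_mul_div, le_div_iff₀ hD]
      nlinarith [abs_nonneg g]
    have : 0 ≤ 8 / (D + 4) * N₁ := by positivity
    linarith
  · rw [abs_of_pos (by linarith)] at h2
    have : |g| ≤ 8 / (D + 4) * N₁ := by
      rw [div_mul_eq_mul_div, le_div_iff₀ (by linarith)]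
      nlinarith [abs_nonneg g]
    have : 0 ≤ 4 * c / D * N₀ := by positivity
    linarith

end

/-! ### The Stein equation of the chi-square law -/

theorem MemCb.abs_le_supNorm {k : ℕ} {h : ℝ → ℝ} (hh : MemCb k h) {i : ℕ} (hi : i ≤ k) {x : ℝ}
    (hx : 0 < x) : |iteratedDeriv i h x| ≤ supNorm (iteratedDeriv i h) := by
  obtain ⟨C, hC⟩ := hh.bounded i hi
  exact le_ciSup (f := fun x : Ioi (0 : ℝ) => |iteratedDeriv i h x|)
    ⟨C, by rintro _ ⟨y, rfl⟩; exact hC y y.2⟩ ⟨x, hx⟩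

theorem supNorm_nonneg (f : ℝ → ℝ) : 0 ≤ supNorm f := Real.iSup_nonneg fun _ => abs_nonneg _

theorem MemCb.hasDerivAt {k : ℕ} {h : ℝ → ℝ} (hh : MemCb k h) {i : ℕ} (hi : i < k) {x : ℝ}
    (hx : 0 < x) : HasDerivAt (iteratedDeriv i h) (iteratedDeriv (i + 1) h x) x := by
  rw [iteratedDeriv_succ]
  exact ((hh.differentiableOn i hi).differentiableAt (Ioi_mem_nhds hx)).hasDerivAt

section

variable {d : ℕ} {h : ℝ → ℝ}

theorem isProbabilityMeasure_chiSquareMeasure (hd : 1 ≤ d) :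
    IsProbabilityMeasure (chiSquareMeasure d) :=
  isProbabilityMeasure_gammaMeasure (by positivity) (by norm_num)

theorem ae_chiSquareMeasure_pos (d : ℕ) : ∀ᵐ x ∂(chiSquareMeasure d), 0 < x := by
  rw [chiSquareMeasure, gammaMeasure, ae_withDensity_iff (by
    exact (measurable_gammaPDFReal _ _).ennreal_ofReal)]
  filter_upwards [compl_mem_ae_iff.2 (measure_singleton (0 : ℝ))] with x hx hne
  by_contra hcon
  exact hne (gammaPDF_of_neg (lt_of_le_of_ne (not_lt.1 hcon) hx))

theorem MemCb.integrable_chiSquareMeasure {k : ℕ} (hh : MemCb k h) (hd : 1 ≤ d) :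
    Integrable h (chiSquareMeasure d) := by
  have := isProbabilityMeasure_chiSquareMeasure hd
  have hr : (chiSquareMeasure d).restrict (Ici 0) = chiSquareMeasure d :=
    Measure.restrict_eq_self_of_ae_mem
      ((ae_chiSquareMeasure_pos d).mono fun x hx => hx.le)
  refine Integrable.of_bound (C := supNorm (iteratedDeriv 0 h)) ?_ ?_
  · rw [← hr]
    exact hh.continuousOn.aestronglyMeasurable measurableSet_Ici
  · filter_upwards [ae_chiSquareMeasure_pos d] with x hx
    have := hh.abs_le_supNorm (Nat.zero_le k) hx
    simpa using this

theorem MemCb.abs_integral_chiSquareMeasure_le {k : ℕ} (hh : MemCb k h) (hd : 1 ≤ d) :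
    |∫ x, h x ∂(chiSquareMeasure d)| ≤ supNorm h := by
  have := isProbabilityMeasure_chiSquareMeasure hd
  have h1 := norm_integral_le_of_norm_le_const (μ := chiSquareMeasure d) (f := h)
    (C := supNorm h) (by
      filter_upwards [ae_chiSquareMeasure_pos d] with x hx
      simpa using hh.abs_le_supNorm (Nat.zero_le k) hx)
  simpa using h1

open Filter Topology in
-- By the integrating factor, the weighted solution is the integral from `0` to `x` of the gamma
-- density times the centred `h`, up to a constant. It vanishes at infinity because the centred
-- function has mean zero.
theorem MemCb.exists_stein_primitive {k : ℕ} (hh : MemCb k h) (hd : 1 ≤ d) :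
    ∃ G : ℝ → ℝ, (∀ x, 0 < x → HasDerivAt G
      (((h x - ∫ y, h y ∂(chiSquareMeasure d)) - ((d : ℝ) - x) / 2 * G x) / x) x) ∧
      Tendsto (fun x => x ^ ((d : ℝ) / 2) * Real.exp (-x / 2) * G x) (𝓝[>] 0) (𝓝 0) ∧
      Tendsto (fun x => x ^ ((d : ℝ) / 2) * Real.exp (-x / 2) * G x) atTop (𝓝 0) := by
  have hprob := isProbabilityMeasure_chiSquareMeasure hd
  set c := ∫ y, h y ∂(chiSquareMeasure d) with hc
  have hd0 : (0 : ℝ) < (d : ℝ) / 2 := by positivity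
  have hint := (hh.integrable_chiSquareMeasure hd).sub (integrable_const c)
  have hzero : ∫ x, (h x - c) ∂(chiSquareMeasure d) = 0 := by
    rw [integral_sub (hh.integrable_chiSquareMeasure hd) (integrable_const c)]
    simp [hc]
  set w := gammaPDFReal ((d : ℝ) / 2) (1 / 2) with hw
  have hwn : ∀ x, 0 ≤ w x := gammaPDFReal_nonneg hd0 (by norm_num)
  have hmeas : Measurable (gammaPDF ((d : ℝ) / 2) (1 / 2)) :=
    (measurable_gammaPDFReal _ _).ennreal_ofReal
  have htr : ∀ x, (gammaPDF ((d : ℝ) / 2) (1 / 2) x).toReal = w x := fun x =>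
    ENNReal.toReal_ofReal (hwn x)
  have hI : Integrable (fun x => w x * (h x - c)) := by
    have := (integrable_withDensity_iff_integrable_smul' hmeas
      (ae_of_all _ fun x => ENNReal.ofReal_lt_top)).1 hint
    simpa only [htr, smul_eq_mul, Pi.sub_apply] using this
  have hI0 : ∫ x, w x * (h x - c) = 0 := by
    rw [← hzero, chiSquareMeasure, gammaMeasure, integral_withDensity_eq_integral_toReal_smul hmeas
      (ae_of_all _ fun x => ENNReal.ofReal_lt_top)]
    simp only [htr, smul_eq_mul]
  have hIoi : ∫ x in Ioi 0, w x * (h x - c) = 0 := by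
    rw [← integral_Ici_eq_integral_Ioi]
    refine (setIntegral_eq_integral_of_forall_compl_eq_zero fun x hx => ?_).trans hI0
    have hx' : ¬ 0 ≤ x := hx
    simp only [hw, gammaPDFReal, if_neg hx', zero_mul]
  set K := (1 / 2 : ℝ) ^ ((d : ℝ) / 2) / Real.Gamma ((d : ℝ) / 2) with hK
  have hK0 : 0 < K := by have := Real.Gamma_pos_of_pos hd0; positivity
  set E : ℝ → ℝ := fun x => ∫ t in (0 : ℝ)..x, w t * (h t - c) with hE
  have hE0 : Tendsto E (𝓝[>] 0) (𝓝 0) := by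
    have := (intervalIntegral.continuous_primitive (fun a b => hI.intervalIntegrable) 0).tendsto 0
    simp only [intervalIntegral.integral_same] at this
    exact this.mono_left nhdsWithin_le_nhds
  have hE1 : Tendsto E atTop (𝓝 0) := by
    rw [← hIoi]
    exact intervalIntegral_tendsto_integral_Ioi 0 hI.integrableOn tendsto_id
  have hcont : ContinuousOn (fun t => w t * (h t - c)) (Ioi 0) := by
    have h1 : ContinuousOn (fun t : ℝ => K * t ^ ((d : ℝ) / 2 - 1) * Real.exp (-(1 / 2 * t))
        * (h t - c)) (Ioi 0) := by
      refine ContinuousOn.mul (ContinuousOn.mul (continuousOn_const.mul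
        (continuousOn_id.rpow_const fun x hx => Or.inl (ne_of_gt hx))) (by fun_prop))
        ((hh.continuousOn.mono Ioi_subset_Ici_self).sub continuousOn_const)
    refine h1.congr fun t ht => ?_
    simp only [hw, gammaPDFReal, if_pos (le_of_lt (mem_Ioi.1 ht)), hK]
  have hEd : ∀ x, 0 < x → HasDerivAt E (w x * (h x - c)) x := fun x hx =>
    intervalIntegral.integral_hasDerivAt_right hI.intervalIntegrable
      (hcont.stronglyMeasurableAtFilter isOpen_Ioi _ hx) (hcont.continuousAt (Ioi_mem_nhds hx))
  refine ⟨fun x => K⁻¹ * (x ^ (-((d : ℝ) / 2)) * Real.exp (x / 2) * E x), fun x hx => ?_, ?_, ?_⟩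
  · have h1 := Real.hasDerivAt_rpow_const (x := x) (p := -((d : ℝ) / 2)) (Or.inl hx.ne')
    have h2 : HasDerivAt (fun x : ℝ => Real.exp (x / 2)) (Real.exp (x / 2) * (1 / 2)) x :=
      ((hasDerivAt_id x).div_const 2).exp
    refine (((h1.mul h2).mul (hEd x hx)).const_mul K⁻¹).congr_deriv ?_
    have e1 : x ^ (-((d : ℝ) / 2) - 1) = x ^ (-((d : ℝ) / 2)) / x := Real.rpow_sub_one hx.ne' _
    have e2 : w x = K * (x ^ (-((d : ℝ) / 2)))⁻¹ / x * (Real.exp (x / 2))⁻¹ := by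
      simp only [hw, gammaPDFReal, if_pos hx.le, ← hK]
      rw [Real.rpow_sub_one hx.ne', Real.rpow_neg hx.le, ← Real.exp_neg, inv_inv]
      ring_nf
    have e3 : x ^ (-((d : ℝ) / 2)) ≠ 0 := (Real.rpow_pos_of_pos hx _).ne'
    simp only [Pi.mul_apply, e1, e2]
    field_simp
    ring
  all_goals
    have key : ∀ x : ℝ, 0 < x → K⁻¹ * E x = x ^ ((d : ℝ) / 2) * Real.exp (-x / 2)
        * (K⁻¹ * (x ^ (-((d : ℝ) / 2)) * Real.exp (x / 2) * E x)) := by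
      intro x hx
      have e4 : Real.exp (-x / 2) = (Real.exp (x / 2))⁻¹ := by rw [← Real.exp_neg]; ring_nf
      have := (Real.rpow_pos_of_pos hx ((d : ℝ) / 2)).ne'
      rw [Real.rpow_neg hx.le, e4]
      field_simp
  · have := hE0.const_mul K⁻¹
    rw [mul_zero] at this
    exact this.congr' (by filter_upwards [self_mem_nhdsWithin] with x hx using key x hx)
  · have := hE1.const_mul K⁻¹
    rw [mul_zero] at this
    exact this.congr' (by filter_upwards [eventually_gt_atTop 0] with x hx using key x hx)

/-- The solution of the Stein equation of the chi-square distribution and bounds of order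
`1 / (d + 2)` for its derivatives. -/
theorem MemCb.exists_stein_solution (hh : MemCb 5 h) (hd : 1 ≤ d) :
    ∃ φ : ℕ → ℝ → ℝ, (∀ k ≤ 5, ∀ x, 0 < x → HasDerivAt (φ k) (φ (k + 1) x) x) ∧
      (∀ x, 0 < x → x * φ 1 x + ((d : ℝ) - x) / 2 * φ 0 x
        = h x - ∫ y, h y ∂(chiSquareMeasure d)) ∧
      (∃ B, ∀ x, 0 < x → |φ 0 x| ≤ B) ∧
      (∀ x, 0 < x → |φ 1 x| ≤ 4 / ((d : ℝ) + 2)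
        * (6 * supNorm h + 2 * supNorm (iteratedDeriv 1 h))) ∧
      ∀ k, 1 ≤ k → k ≤ 4 → ∀ x, 0 < x → |φ (k + 1) x| ≤ 4 / ((d : ℝ) + 2)
        * (2 * supNorm (iteratedDeriv k h) + 2 * supNorm (iteratedDeriv (k + 1) h)) := by
  obtain ⟨G, hG, h0, h1⟩ := hh.exists_stein_primitive hd
  set c := ∫ y, h y ∂(chiSquareMeasure d) with hc
  set q : ℕ → ℝ → ℝ := fun k x => iteratedDeriv k h x - if k = 0 then c else 0 with hq
  set N : ℕ → ℝ := fun k => (if k = 0 then 2 else 1) * supNorm (iteratedDeriv k h) with hN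
  have hd1 : (1 : ℝ) ≤ d := by exact_mod_cast hd
  have hsn := fun k => supNorm_nonneg (iteratedDeriv k h)
  have hNn : ∀ k, 0 ≤ N k := fun k => by
    have := hsn k
    simp only [hN]; positivity
  have hqd : ∀ k < 5, ∀ x, 0 < x → HasDerivAt (q k) (q (k + 1) x) x := by
    intro k hk x hx
    have := (hh.hasDerivAt hk hx).sub_const (if k = 0 then c else 0)
    simpa [hq] using this
  have hqN : ∀ k ≤ 5, ∀ x, 0 < x → |q k x| ≤ N k := by
    intro k hk x hx
    have h2 := hh.abs_le_supNorm hk hx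
    rcases Nat.eq_zero_or_pos k with rfl | hk0
    · simp only [hq, hN, if_true, iteratedDeriv_zero] at h2 ⊢
      have := hh.abs_integral_chiSquareMeasure_le hd
      have h3 := abs_sub (h x) c
      linarith
    · simpa [hq, hN, hk0.ne'] using h2
  have hG' : ∀ x, 0 < x → HasDerivAt G ((steinPair d q G 1).1 x) x := by
    intro x hx
    have := hG x hx
    simpa [steinPair, hq] using this
  have hb := steinPair_bounds hd1 hqd hqN hG' h0 h1
  have hder := fun k => (hasDerivAt_steinPair hqd hG' k).1
  have hsucc : ∀ k, k ≤ 4 → ∀ x, 0 < x → |(steinPair d q G (k + 1)).1 x|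
      ≤ 4 * (if k = 0 then 1 else 2) / (d + 2 * k) * N k + 8 / (d + 2 * k + 4) * N (k + 1) := by
    intro k hk x hx
    have b1 := (hb k (by omega)).2.2.2 x hx
    have b2 := (hb (k + 1) (by omega)).2.2.1 x hx
    refine abs_le_of_abs_mul_le (by positivity) hx (hNn k) (hNn (k + 1)) b1 ?_ (by positivity)
    simp only [Nat.succ_ne_zero, if_false] at b2
    push_cast at b2
    convert b2 using 1
    · ring_nf
    · ring
  refine ⟨fun k => (steinPair d q G k).1, hder, fun x hx => ?_, (hb 0 (by norm_num)).1,
    fun x hx => ?_, fun k hk1 hk4 x hx => ?_⟩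
  · have := steinPair_equation (d := d) (q := q) (G := G) 0 hx
    simpa [steinPair, hq] using this
  · refine (hsucc 0 (by norm_num) x hx).trans ?_
    -- The loss of a factor `3`, sharp at `d = 1`, produces the coefficient `6` of `supNorm h`.
    have e1 : 4 / (d : ℝ) ≤ 12 / (d + 2) := by
      rw [div_le_div_iff₀ (by positivity) (by positivity)]; linarith
    have e2 : 8 / ((d : ℝ) + 4) ≤ 8 / (d + 2) := by gcongr; norm_num
    have s0 := hsn 0
    have s1 := hsn 1
    rw [iteratedDeriv_zero] at s0
    simp only [hN, iteratedDeriv_zero, if_true, zero_add, one_ne_zero, if_false, Nat.cast_zero,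
      mul_zero, add_zero, mul_one, one_mul]
    calc 4 / (d : ℝ) * (2 * supNorm h) + 8 / ((d : ℝ) + 4) * supNorm (iteratedDeriv 1 h)
        ≤ 12 / (d + 2) * (2 * supNorm h) + 8 / ((d : ℝ) + 2) * supNorm (iteratedDeriv 1 h) := by
          gcongr
      _ = 4 / ((d : ℝ) + 2) * (6 * supNorm h + 2 * supNorm (iteratedDeriv 1 h)) := by ring
  · refine (hsucc k hk4 x hx).trans ?_
    have hk0 : k ≠ 0 := by omega
    have hk' : (1 : ℝ) ≤ k := by exact_mod_cast hk1
    have s0 := hsn k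
    have s1 := hsn (k + 1)
    simp only [hN, if_neg hk0, Nat.succ_ne_zero, if_false, one_mul]
    calc _ ≤ 4 * 2 / ((d : ℝ) + 2) * supNorm (iteratedDeriv k h)
          + 8 / ((d : ℝ) + 2) * supNorm (iteratedDeriv (k + 1) h) := by
          gcongr <;> linarith
      _ = _ := by ring

end

/-! ### Random walks as products of commuting shift operators -/

theorem exp_neg_two_lt : Real.exp (-2) < 70 / 512 := by
  have h := Real.exp_one_gt_d9
  have e : Real.exp (-2) = (Real.exp 1 ^ 2)⁻¹ := by rw [← Real.exp_nat_mul, ← Real.exp_neg]; norm_num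
  rw [e, inv_lt_comm₀ (by positivity) (by norm_num)]
  have : (2.7182818283 : ℝ) ^ 2 < Real.exp 1 ^ 2 := by gcongr
  norm_num at this ⊢
  linarith

section Walk

variable {ι J : Type*} [Fintype ι]

/-- The operator `F ↦ ∑ k, c k * F (· + ε • ξ k)` on functions of a vector. -/
def shiftOp (ξ : ι → J → ℝ) (c : ι → ℝ) (ε : ℝ) : Module.End ℝ ((J → ℝ) → ℝ) where
  toFun F s := ∑ k, c k * F (s + ε • ξ k)
  map_add' F G := by
    funext s; simp only [Pi.add_apply, mul_add, Finset.sum_add_distrib]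
  map_smul' a F := by
    funext s
    simp only [Pi.smul_apply, smul_eq_mul, RingHom.id_apply, Finset.mul_sum]
    exact Finset.sum_congr rfl fun k _ => by ring

variable {ξ : ι → J → ℝ} {p : ι → ℝ}

theorem shiftOp_apply (c : ι → ℝ) (ε : ℝ) (F : (J → ℝ) → ℝ) (s : J → ℝ) :
    shiftOp ξ c ε F s = ∑ k, c k * F (s + ε • ξ k) := rfl

theorem commute_shiftOp (c c' : ι → ℝ) (ε ε' : ℝ) :
    Commute (shiftOp ξ c ε) (shiftOp ξ c' ε') := by
  refine LinearMap.ext fun F => funext fun s => ?_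
  simp only [Module.End.mul_apply, shiftOp_apply, Finset.mul_sum]
  rw [Finset.sum_comm]
  refine Finset.sum_congr rfl fun k _ => Finset.sum_congr rfl fun l _ => ?_
  rw [add_right_comm]; ring

/-- The expectation of `F` at the end of a random walk which starts at `0` and makes `a` steps
distributed as `ξ` and `b` steps distributed as `-ξ`, where the value `ξ k` has probability
`p k`. -/
def walkE (ξ : ι → J → ℝ) (p : ι → ℝ) (a b : ℕ) : ((J → ℝ) → ℝ) →ₗ[ℝ] ℝ :=
  LinearMap.proj 0 ∘ₗ (shiftOp ξ p 1 ^ a * shiftOp ξ p (-1) ^ b)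

theorem walkE_apply (a b : ℕ) (F : (J → ℝ) → ℝ) :
    walkE ξ p a b F = (shiftOp ξ p 1 ^ a) ((shiftOp ξ p (-1) ^ b) F) 0 := rfl

/-- `H` is a set which the walk cannot leave, so pointwise inequalities are needed only on it; later
it is a hyperplane. -/
theorem shiftOp_pow_mono {H : (J → ℝ) → Prop} (hp : ∀ k, 0 ≤ p k)
    (hH : ∀ s k (ε : ℝ), H s → H (s + ε • ξ k)) (ε : ℝ) (a : ℕ) {F G : (J → ℝ) → ℝ}
    (hFG : ∀ s, H s → F s ≤ G s) {s : J → ℝ} (hs : H s) :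
    (shiftOp ξ p ε ^ a) F s ≤ (shiftOp ξ p ε ^ a) G s := by
  induction a generalizing s with
  | zero => exact hFG s hs
  | succ a ih =>
    rw [pow_succ', Module.End.mul_apply, Module.End.mul_apply, shiftOp_apply, shiftOp_apply]
    exact Finset.sum_le_sum fun k _ => mul_le_mul_of_nonneg_left (ih (hH s k ε hs)) (hp k)

section

variable {H : (J → ℝ) → Prop} (hp : ∀ k, 0 ≤ p k) (hH : ∀ s k (ε : ℝ), H s → H (s + ε • ξ k))
  (h0 : H 0)
include hp hH h0

theorem walkE_mono (a b : ℕ) {F G : (J → ℝ) → ℝ} (hFG : ∀ s, H s → F s ≤ G s) :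
    walkE ξ p a b F ≤ walkE ξ p a b G :=
  shiftOp_pow_mono hp hH 1 a (fun _ hs => shiftOp_pow_mono hp hH (-1) b hFG hs) h0

theorem walkE_congr (a b : ℕ) {F G : (J → ℝ) → ℝ} (hFG : ∀ s, H s → F s = G s) :
    walkE ξ p a b F = walkE ξ p a b G :=
  le_antisymm (walkE_mono hp hH h0 a b fun s hs => (hFG s hs).le)
    (walkE_mono hp hH h0 a b fun s hs => (hFG s hs).ge)

theorem abs_walkE_le (a b : ℕ) {F G : (J → ℝ) → ℝ} (hFG : ∀ s, H s → |F s| ≤ G s) :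
    |walkE ξ p a b F| ≤ walkE ξ p a b G := by
  rw [abs_le, ← map_neg]
  exact ⟨walkE_mono hp hH h0 a b fun s hs => (abs_le.1 (hFG s hs)).1,
    walkE_mono hp hH h0 a b fun s hs => (abs_le.1 (hFG s hs)).2⟩

end

theorem shiftOp_pow_const (hp1 : ∑ k, p k = 1) (ε : ℝ) (a : ℕ) (c : ℝ) :
    (shiftOp ξ p ε ^ a) (fun _ => c) = fun _ => c := by
  induction a with
  | zero => rfl
  | succ a ih =>
    rw [pow_succ', Module.End.mul_apply, ih]
    funext s
    rw [shiftOp_apply, ← Finset.sum_mul, hp1, one_mul]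

theorem walkE_const (hp1 : ∑ k, p k = 1) (a b : ℕ) (c : ℝ) :
    walkE ξ p a b (fun _ => c) = c := by
  rw [walkE_apply, shiftOp_pow_const hp1, shiftOp_pow_const hp1]

/-- A commutator identity: multiplication by `s j` passes each of the `N + 1` shifts at the cost of
one shift weighted by `ξ k j`, and all shifts commute. At the origin it becomes the exchangeability
identity `E S_j F(S) = (N + 1) E ξ_j F(S' + ξ)`, where `S'` has one step fewer. -/
theorem shiftOp_pow_coord_mul (j : J) (N : ℕ) (F : (J → ℝ) → ℝ) :
    (shiftOp ξ p 1 ^ (N + 1)) (fun s => s j * F s)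
      = (fun s => s j * (shiftOp ξ p 1 ^ (N + 1)) F s)
        + ((N : ℝ) + 1) • (shiftOp ξ p 1 ^ N) (shiftOp ξ (fun k => p k * ξ k j) 1 F) := by
  have key : ∀ F : (J → ℝ) → ℝ, shiftOp ξ p 1 (fun s => s j * F s)
      = (fun s => s j * shiftOp ξ p 1 F s) + shiftOp ξ (fun k => p k * ξ k j) 1 F := by
    intro F
    funext s
    simp only [shiftOp_apply, Pi.add_apply, Pi.smul_apply, smul_eq_mul, one_mul, Finset.mul_sum,
      ← Finset.sum_add_distrib]
    exact Finset.sum_congr rfl fun k _ => by ring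
  induction N generalizing F with
  | zero => simpa using key F
  | succ N ih =>
    have hc := fun N => ((commute_shiftOp (ξ := ξ) p (fun k => p k * ξ k j) 1 1).pow_left N).eq
    rw [pow_succ, Module.End.mul_apply, key, map_add, ih, add_assoc]
    congr 1
    have e : (shiftOp ξ p 1 ^ N) (shiftOp ξ (fun k => p k * ξ k j) 1 (shiftOp ξ p 1 F))
        = (shiftOp ξ p 1 ^ (N + 1)) (shiftOp ξ (fun k => p k * ξ k j) 1 F) := by
      rw [pow_succ, Module.End.mul_apply, ← Module.End.mul_apply (shiftOp ξ p 1),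
        (commute_shiftOp (ξ := ξ) p (fun k => p k * ξ k j) 1 1).eq, Module.End.mul_apply]
    rw [e]
    push_cast
    module

theorem walkE_coord_mul (j : J) (N : ℕ) (F : (J → ℝ) → ℝ) :
    walkE ξ p (N + 1) 0 (fun s => s j * F s)
      = ((N : ℝ) + 1) * walkE ξ p N 0 (shiftOp ξ (fun k => p k * ξ k j) 1 F) := by
  simp only [walkE_apply, pow_zero, Module.End.one_apply]
  rw [shiftOp_pow_coord_mul]
  simp

theorem walkE_succ (N : ℕ) (F : (J → ℝ) → ℝ) :
    walkE ξ p (N + 1) 0 F = walkE ξ p N 0 (shiftOp ξ p 1 F) := by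
  simp only [walkE_apply, pow_zero, Module.End.one_apply]
  rw [pow_succ, Module.End.mul_apply]

theorem shiftOp_neg_pow (N : ℕ) (F : (J → ℝ) → ℝ) (s : J → ℝ) :
    (shiftOp ξ p (-1) ^ N) F s = (shiftOp ξ p 1 ^ N) (fun s => F (-s)) (-s) := by
  induction N generalizing s with
  | zero => simp
  | succ N ih =>
    rw [pow_succ', pow_succ', Module.End.mul_apply, Module.End.mul_apply, shiftOp_apply,
      shiftOp_apply]
    refine Finset.sum_congr rfl fun k _ => ?_
    rw [ih, neg_add]
    simp

/-- For odd `F`, reversing every step changes the sign of the expectation. The difference of the two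
expectations telescopes as `A ^ N - B ^ N` for the commuting forward and backward shifts. -/
theorem walkE_eq_half_of_odd (N : ℕ) {F : (J → ℝ) → ℝ} (hF : ∀ s, F (-s) = -F s) :
    walkE ξ p N 0 F = (∑ i ∈ Finset.range N,
      walkE ξ p i (N - 1 - i) (shiftOp ξ p 1 F - shiftOp ξ p (-1) F)) / 2 := by
  have h1 : walkE ξ p 0 N F = -walkE ξ p N 0 F := by
    simp only [walkE_apply, pow_zero, Module.End.one_apply]
    rw [shiftOp_neg_pow, neg_zero]
    have : (fun s => F (-s)) = -F := funext hF
    rw [this, map_neg, Pi.neg_apply]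
  have h2 := (commute_shiftOp (ξ := ξ) p p 1 (-1)).geom_sum₂_mul N
  have h3 := congrArg (fun L : Module.End ℝ ((J → ℝ) → ℝ) => L F 0) h2
  simp only [Module.End.mul_apply, LinearMap.sub_apply, LinearMap.sum_apply, Pi.sub_apply,
    Finset.sum_apply] at h3
  have h4 : walkE ξ p N 0 F - walkE ξ p 0 N F = ∑ i ∈ Finset.range N,
      walkE ξ p i (N - 1 - i) (shiftOp ξ p 1 F - shiftOp ξ p (-1) F) := by
    simp only [walkE_apply, pow_zero, Module.End.one_apply]
    exact h3.symm
  rw [← h4, h1]; ring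

theorem shiftOp_pow_exp_le (hp : ∀ k, 0 ≤ p k) {j : J} {σ ε b : ℝ}
    (hb : ∑ k, p k * Real.exp (σ * (ε * ξ k j)) ≤ Real.exp b) (a : ℕ) {C : ℝ} (hC : 0 ≤ C)
    {F : (J → ℝ) → ℝ} (hF : ∀ s, F s ≤ C * Real.exp (σ * s j)) (s : J → ℝ) :
    (shiftOp ξ p ε ^ a) F s ≤ C * Real.exp (a * b) * Real.exp (σ * s j) := by
  induction a generalizing s with
  | zero => simpa using hF s
  | succ a ih =>
    rw [pow_succ', Module.End.mul_apply, shiftOp_apply]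
    calc ∑ k, p k * (shiftOp ξ p ε ^ a) F (s + ε • ξ k)
        ≤ ∑ k, p k * (C * Real.exp (a * b) * Real.exp (σ * (s + ε • ξ k) j)) :=
          Finset.sum_le_sum fun k _ => mul_le_mul_of_nonneg_left (ih _) (hp k)
      _ = C * Real.exp (a * b) * Real.exp (σ * s j)
          * ∑ k, p k * Real.exp (σ * (ε * ξ k j)) := by
          rw [Finset.mul_sum]
          refine Finset.sum_congr rfl fun k _ => ?_
          rw [Pi.add_apply, Pi.smul_apply, smul_eq_mul, mul_add, Real.exp_add]; ring
      _ ≤ C * Real.exp (a * b) * Real.exp (σ * s j) * Real.exp b := by gcongr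
      _ = _ := by
          push_cast
          rw [add_mul, one_mul, Real.exp_add]; ring

/-- Uses `exp x ≤ 1 + x + x²` for `|x| ≤ 1`, then `1 + v ≤ exp v`. -/
theorem sum_mul_exp_le (hp : ∀ k, 0 ≤ p k) (hp1 : ∑ k, p k = 1) {x : ι → ℝ} {v : ℝ}
    (h0 : ∑ k, p k * x k = 0) (h2 : ∑ k, p k * x k ^ 2 ≤ v) (hx : ∀ k, |x k| ≤ 1) :
    ∑ k, p k * Real.exp (x k) ≤ Real.exp v := by
  calc ∑ k, p k * Real.exp (x k) ≤ ∑ k, p k * (1 + x k + x k ^ 2) := by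
        refine Finset.sum_le_sum fun k _ => mul_le_mul_of_nonneg_left ?_ (hp k)
        have := (abs_le.1 (Real.abs_exp_sub_one_sub_id_le (hx k))).2
        linarith
    _ = ∑ k, p k + ∑ k, p k * x k + ∑ k, p k * x k ^ 2 := by
        rw [← Finset.sum_add_distrib, ← Finset.sum_add_distrib]
        exact Finset.sum_congr rfl fun k _ => by ring
    _ ≤ v + 1 := by rw [hp1, h0]; linarith
    _ ≤ Real.exp v := Real.add_one_le_exp v

/-! ### Moments of one coordinate of the walk -/

section Moments

variable {n : ℕ} (hn : 0 < n) (hp : ∀ k, 0 ≤ p k) (hp1 : ∑ k, p k = 1) {j : J}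
  (hmean : ∑ k, p k * ξ k j = 0) (hvar : ∑ k, p k * ξ k j ^ 2 ≤ 1 / n) (hξ : ∀ k, |ξ k j| ≤ 1)
include hn hp hp1 hmean hvar hξ

theorem walkE_exp_le {a b : ℕ} (hab : a + b ≤ n) {σ : ℝ} (hσ : σ = 1 ∨ σ = -1) :
    walkE ξ p a b (fun s => Real.exp (σ * s j)) ≤ Real.exp 1 := by
  have key : ∀ ε : ℝ, (ε = 1 ∨ ε = -1) →
      ∑ k, p k * Real.exp (σ * (ε * ξ k j)) ≤ Real.exp (1 / n) := by
    intro ε hε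
    have h1 : ∀ k, σ * (ε * ξ k j) = ξ k j ∨ σ * (ε * ξ k j) = -ξ k j := by
      intro k
      rcases hσ with rfl | rfl <;> rcases hε with rfl | rfl <;> simp
    refine sum_mul_exp_le hp hp1 ?_ (le_trans (le_of_eq ?_) hvar) fun k => ?_
    · have : ∑ k, p k * (σ * (ε * ξ k j)) = σ * ε * ∑ k, p k * ξ k j := by
        rw [Finset.mul_sum]; exact Finset.sum_congr rfl fun k _ => by ring
      rw [this, hmean, mul_zero]
    · refine Finset.sum_congr rfl fun k _ => ?_
      rcases h1 k with h | h <;> rw [h]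
      rw [neg_sq]
    · rcases h1 k with h | h <;> rw [h]
      · exact hξ k
      · rw [abs_neg]; exact hξ k
  have h1 := fun s => shiftOp_pow_exp_le hp (key (-1) (Or.inr rfl)) b (C := 1) zero_le_one
    (F := fun s => Real.exp (σ * s j)) (fun s => by simp) s
  have h2 := shiftOp_pow_exp_le hp (key 1 (Or.inl rfl)) a (by positivity) h1 0
  rw [walkE_apply]
  refine h2.trans ?_
  rw [Pi.zero_apply, mul_zero, Real.exp_zero, mul_one, one_mul, ← Real.exp_add]
  refine Real.exp_le_exp.2 ?_
  have hn' : (0 : ℝ) < n := by exact_mod_cast hn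
  have : (a : ℝ) + b ≤ n := by exact_mod_cast hab
  rw [← add_mul, mul_one_div, div_le_one hn']
  linarith

/-- The tangent inequality `y ≤ exp (y - 1)` at `y = (1 + |s j|) / k`, raised to the power `k`,
reduces this to the exponential moments of `s j` and `-s j`, each at most `exp 1`. -/
theorem walkE_one_add_abs_pow_le {a b : ℕ} (hab : a + b ≤ n) {k : ℕ} (hk : 0 < k) :
    walkE ξ p a b (fun s => (1 + |s j|) ^ k) ≤ 2 * k ^ k * Real.exp (2 - k) := by
  have hk' : (0 : ℝ) < k := by exact_mod_cast hk
  have hpt : ∀ s : J → ℝ, True → (1 + |s j|) ^ k ≤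
      ((((k : ℝ) ^ k * Real.exp (1 - k)) • ((fun s : J → ℝ => Real.exp (1 * s j))
        + fun s => Real.exp (-1 * s j))) : (J → ℝ) → ℝ) s := by
    intro s _
    simp only [Pi.smul_apply, Pi.add_apply, smul_eq_mul, one_mul, neg_one_mul]
    have h1 : Real.exp |s j| ≤ Real.exp (s j) + Real.exp (-s j) := by
      rcases abs_cases (s j) with ⟨h, _⟩ | ⟨h, _⟩ <;> rw [h] <;>
        linarith [Real.exp_pos (s j), Real.exp_pos (-s j)]
    have h2 : (1 + |s j|) / k ≤ Real.exp ((1 + |s j|) / k - 1) := by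
      linarith [Real.add_one_le_exp ((1 + |s j|) / k - 1)]
    have h3 : ((1 + |s j|) / k) ^ k ≤ Real.exp ((1 + |s j|) / k - 1) ^ k := by
      gcongr
    rw [← Real.exp_nat_mul, div_pow, div_le_iff₀ (by positivity)] at h3
    have e : (k : ℝ) * ((1 + |s j|) / k - 1) = (1 - k) + |s j| := by field_simp; ring
    rw [e, Real.exp_add] at h3
    calc (1 + |s j|) ^ k ≤ Real.exp (1 - k) * Real.exp |s j| * k ^ k := h3
      _ ≤ Real.exp (1 - k) * (Real.exp (s j) + Real.exp (-s j)) * k ^ k := by gcongr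
      _ = _ := by ring
  have h1 := walkE_mono (ξ := ξ) (H := fun _ => True) hp (fun _ _ _ _ => trivial) trivial a b hpt
  rw [map_smul, map_add, smul_eq_mul] at h1
  have h2 := walkE_exp_le hn hp hp1 hmean hvar hξ hab (σ := 1) (Or.inl rfl)
  have h3 := walkE_exp_le hn hp hp1 hmean hvar hξ hab (σ := -1) (Or.inr rfl)
  refine h1.trans ?_
  calc _ ≤ ((k : ℝ) ^ k * Real.exp (1 - k)) * (Real.exp 1 + Real.exp 1) := by gcongr
    _ = 2 * k ^ k * (Real.exp (1 - k) * Real.exp 1) := by ring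
    _ = _ := by rw [← Real.exp_add]; ring_nf

theorem walkE_one_add_abs_sq_le {a b : ℕ} (hab : a + b ≤ n) :
    walkE ξ p a b (fun s => (1 + |s j|) ^ 2) ≤ 8 := by
  refine (walkE_one_add_abs_pow_le hn hp hp1 hmean hvar hξ hab (k := 2) (by norm_num)).trans ?_
  norm_num

theorem walkE_one_add_abs_pow_four_le {a b : ℕ} (hab : a + b ≤ n) :
    walkE ξ p a b (fun s => (1 + |s j|) ^ 4) ≤ 70 := by
  refine (walkE_one_add_abs_pow_le hn hp hp1 hmean hvar hξ hab (k := 4) (by norm_num)).trans ?_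
  have := exp_neg_two_lt
  norm_num at this ⊢
  linarith

theorem walkE_one_add_abs_pow_six_le {a b : ℕ} (hab : a + b ≤ n) :
    walkE ξ p a b (fun s => (1 + |s j|) ^ 6) ≤ 1800 := by
  refine (walkE_one_add_abs_pow_le hn hp hp1 hmean hvar hξ hab (k := 6) (by norm_num)).trans ?_
  have h := exp_neg_two_lt
  have e : Real.exp (-4) = Real.exp (-2) ^ 2 := by rw [← Real.exp_nat_mul]; norm_num
  have : Real.exp (-2) ^ 2 < (70 / 512) ^ 2 := by gcongr
  norm_num at this e ⊢
  linarith

end Moments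

end Walk

/-! ### Taylor estimates in one variable -/

section Taylor

theorem abs_le_of_abs_deriv_le_pow {f f₁ : ℝ → ℝ} {B : ℝ} (k : ℕ)
    (hf : ∀ t ∈ Icc (0 : ℝ) 1, HasDerivAt f (f₁ t) t) (h0 : f 0 = 0)
    (hb : ∀ t ∈ Icc (0 : ℝ) 1, |f₁ t| ≤ B * t ^ k) {t : ℝ} (ht : t ∈ Icc (0 : ℝ) 1) :
    |f t| ≤ B / (k + 1) * t ^ (k + 1) := by
  have hk : (k : ℝ) + 1 ≠ 0 := by positivity
  refine image_norm_le_of_norm_deriv_right_le_deriv_boundary (f := f) (f' := f₁) (a := 0) (b := 1)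
    (B := fun t => B / (k + 1) * t ^ (k + 1)) (B' := fun t => B * t ^ k)
    (fun x hx => (hf x hx).continuousAt.continuousWithinAt)
    (fun x hx => (hf x ⟨hx.1, hx.2.le⟩).hasDerivWithinAt) (by simp [h0]) (fun x => ?_)
    (fun x hx => hb x ⟨hx.1, hx.2.le⟩) ht
  refine ((hasDerivAt_pow (k + 1) x).const_mul (B / (k + 1))).congr_deriv ?_
  push_cast
  field_simp

variable {f f₁ f₂ f₃ : ℝ → ℝ} {B : ℝ}

theorem abs_taylor_two_le (h1 : ∀ t ∈ Icc (0 : ℝ) 1, HasDerivAt f (f₁ t) t)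
    (h2 : ∀ t ∈ Icc (0 : ℝ) 1, HasDerivAt f₁ (f₂ t) t)
    (hb : ∀ t ∈ Icc (0 : ℝ) 1, |f₂ t| ≤ B) : |f 1 - f 0 - f₁ 0| ≤ B / 2 := by
  have e1 := fun t ht => abs_le_of_abs_deriv_le_pow (f := fun t => f₁ t - f₁ 0) (f₁ := f₂) (B := B) 0
    (fun t ht => (h2 t ht).sub_const _) (by simp) (by simpa using hb) (t := t) ht
  have e2 := abs_le_of_abs_deriv_le_pow (f := fun t => f t - f 0 - t * f₁ 0)
    (f₁ := fun t => f₁ t - f₁ 0) (B := B) 1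
    (fun t ht => (((h1 t ht).sub_const _).sub ((hasDerivAt_id t).mul_const _)).congr_deriv (by ring))
    (by simp) (by simpa using e1) (t := 1) (by simp)
  norm_num at e2
  exact e2

theorem abs_taylor_three_le (h1 : ∀ t ∈ Icc (0 : ℝ) 1, HasDerivAt f (f₁ t) t)
    (h2 : ∀ t ∈ Icc (0 : ℝ) 1, HasDerivAt f₁ (f₂ t) t)
    (h3 : ∀ t ∈ Icc (0 : ℝ) 1, HasDerivAt f₂ (f₃ t) t)
    (hb : ∀ t ∈ Icc (0 : ℝ) 1, |f₃ t| ≤ B) : |f 1 - f 0 - f₁ 0 - f₂ 0 / 2| ≤ B / 6 := by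
  have e1 := fun t ht => abs_le_of_abs_deriv_le_pow (f := fun t => f₂ t - f₂ 0) (f₁ := f₃) (B := B) 0
    (fun t ht => (h3 t ht).sub_const _) (by simp) (by simpa using hb) (t := t) ht
  have e2 := fun t ht => abs_le_of_abs_deriv_le_pow (f := fun t => f₁ t - f₁ 0 - t * f₂ 0)
    (f₁ := fun t => f₂ t - f₂ 0) (B := B) 1
    (fun t ht => (((h2 t ht).sub_const _).sub ((hasDerivAt_id t).mul_const _)).congr_deriv (by ring))
    (by simp) (by simpa using e1) (t := t) ht
  have e3 := abs_le_of_abs_deriv_le_pow (f := fun t => f t - f 0 - t * f₁ 0 - t ^ 2 * (f₂ 0 / 2))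
    (f₁ := fun t => f₁ t - f₁ 0 - t * f₂ 0) (B := B / 2) 2
    (fun t ht => ((((h1 t ht).sub_const _).sub ((hasDerivAt_id t).mul_const _)).sub
      ((hasDerivAt_pow 2 t).mul_const _)).congr_deriv (by push_cast; ring))
    (by simp) (by norm_num at e2 ⊢; exact e2) (t := 1) (by simp)
  norm_num at e3
  convert e3 using 1
  ring

/-- In a symmetric difference the second order terms cancel; this gain makes the reversal of a step
cheap. -/
theorem abs_taylor_odd_le (h1 : ∀ t ∈ Icc (-1 : ℝ) 1, HasDerivAt f (f₁ t) t)
    (h2 : ∀ t ∈ Icc (-1 : ℝ) 1, HasDerivAt f₁ (f₂ t) t)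
    (h3 : ∀ t ∈ Icc (-1 : ℝ) 1, HasDerivAt f₂ (f₃ t) t)
    (hb : ∀ t ∈ Icc (-1 : ℝ) 1, |f₃ t| ≤ B) : |f 1 - f (-1) - 2 * f₁ 0| ≤ B / 3 := by
  have hsub : ∀ t ∈ Icc (0 : ℝ) 1, t ∈ Icc (-1 : ℝ) 1 := fun t ht => ⟨by linarith [ht.1], ht.2⟩
  have hneg : ∀ t ∈ Icc (0 : ℝ) 1, -t ∈ Icc (-1 : ℝ) 1 := fun t ht =>
    ⟨by linarith [ht.2], by linarith [ht.1]⟩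
  have dneg : ∀ {g : ℝ → ℝ} {g' t : ℝ}, HasDerivAt g g' (-t) →
      HasDerivAt (fun t => g (-t)) (-g') t := fun {g g' t} h =>
    (h.comp t (hasDerivAt_neg t)).congr_deriv (by ring)
  have a1 := abs_taylor_three_le (fun t ht => h1 t (hsub t ht)) (fun t ht => h2 t (hsub t ht))
    (fun t ht => h3 t (hsub t ht)) (fun t ht => hb t (hsub t ht))
  have a2 := abs_taylor_three_le (f := fun t => f (-t)) (f₁ := fun t => -f₁ (-t))
    (f₂ := fun t => f₂ (-t)) (f₃ := fun t => -f₃ (-t)) (B := B) (fun t ht => dneg (h1 _ (hneg t ht)))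
    (fun t ht => (dneg (h2 _ (hneg t ht))).neg.congr_deriv (by ring))
    (fun t ht => dneg (h3 _ (hneg t ht)))
    (fun t ht => by rw [abs_neg]; exact hb _ (hneg t ht))
  simp only [neg_zero] at a2
  have e : f 1 - f (-1) - 2 * f₁ 0 = (f 1 - f 0 - f₁ 0 - f₂ 0 / 2)
      - (f (-1) - f 0 - -f₁ 0 - f₂ 0 / 2) := by ring
  rw [e]
  refine (abs_sub _ _).trans ?_
  linarith

end Taylor

/-! ### Taylor estimates along the quadratic path of the squared norm -/

section Quadratic

variable {φ : ℕ → ℝ → ℝ} {C : ℕ → ℝ} {w α β c y : ℝ}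

theorem hasDerivAt_comp_quadratic {k : ℕ}
    (hφ : ∀ k ≤ 4, ∀ x, 0 ≤ x → HasDerivAt (φ k) (φ (k + 1) x) x)
    (hW : ∀ t : ℝ, 0 ≤ w + 2 * t * α + t ^ 2 * β) (hk : k ≤ 4) (t : ℝ) :
    HasDerivAt (fun t => φ k (w + 2 * t * α + t ^ 2 * β))
      (2 * (α + t * β) * φ (k + 1) (w + 2 * t * α + t ^ 2 * β)) t := by
  have h1 : HasDerivAt (fun t : ℝ => w + 2 * t * α + t ^ 2 * β) (2 * (α + t * β)) t :=
    (((((hasDerivAt_id t).const_mul 2).mul_const α).const_add w).add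
      ((hasDerivAt_pow 2 t).mul_const β)).congr_deriv (by push_cast; ring)
  exact ((hφ k hk _ (hW t)).comp t h1).congr_deriv (by ring)

theorem hasDerivAt_linear (α β t : ℝ) : HasDerivAt (fun t => α + t * β) β t :=
  (((hasDerivAt_id t).mul_const β).const_add α).congr_deriv (by ring)

/-- Here `w + 2tα + t²β` is the squared norm after a fraction `t` of a step. As `α + tβ` has order
`c` and `β` order `c²`, every term of the third derivative has order `c⁴`. -/
theorem abs_taylor_mul_phi_le
    (hφ : ∀ k ≤ 4, ∀ x, 0 ≤ x → HasDerivAt (φ k) (φ (k + 1) x) x)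
    (hC : ∀ k, 1 ≤ k → k ≤ 5 → ∀ x, 0 ≤ x → |φ k x| ≤ C k)
    (hW : ∀ t : ℝ, 0 ≤ w + 2 * t * α + t ^ 2 * β) (hβ0 : 0 ≤ β) (hβ : β ≤ c ^ 2)
    (hv : ∀ t : ℝ, |t| ≤ 1 → |α + t * β| ≤ c * y) :
    |(α + β) * φ 0 (w + 2 * α + β) - α * φ 0 w - (β * φ 0 w + 2 * α ^ 2 * φ 1 w)
      - (6 * β * α * φ 1 w + 4 * α ^ 3 * φ 2 w) / 2|
      ≤ c ^ 4 * (C 1 + 4 * y ^ 2 * C 2 + 4 / 3 * y ^ 4 * C 3) := by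
  have D := fun k hk t => hasDerivAt_comp_quadratic (k := k) hφ hW hk t
  have V := hasDerivAt_linear α β
  have key := abs_taylor_three_le
    (f := fun t => (α + t * β) * φ 0 (w + 2 * t * α + t ^ 2 * β))
    (f₁ := fun t => β * φ 0 (w + 2 * t * α + t ^ 2 * β)
      + 2 * (α + t * β) ^ 2 * φ 1 (w + 2 * t * α + t ^ 2 * β))
    (f₂ := fun t => 6 * β * (α + t * β) * φ 1 (w + 2 * t * α + t ^ 2 * β)
      + 4 * (α + t * β) ^ 3 * φ 2 (w + 2 * t * α + t ^ 2 * β))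
    (f₃ := fun t => 6 * β ^ 2 * φ 1 (w + 2 * t * α + t ^ 2 * β)
      + 24 * β * (α + t * β) ^ 2 * φ 2 (w + 2 * t * α + t ^ 2 * β)
      + 8 * (α + t * β) ^ 4 * φ 3 (w + 2 * t * α + t ^ 2 * β))
    (B := 6 * (c ^ 4 * (C 1 + 4 * y ^ 2 * C 2 + 4 / 3 * y ^ 4 * C 3)))
    (fun t _ => ((V t).mul (D 0 (by norm_num) t)).congr_deriv (by ring))
    (fun t _ => (((D 0 (by norm_num) t).const_mul β).add
      ((((V t).pow 2).const_mul 2).mul (D 1 (by norm_num) t))).congr_deriv (by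
        simp only [Pi.pow_apply]; push_cast; ring))
    (fun t _ => ((((V t).const_mul (6 * β)).mul (D 1 (by norm_num) t)).add
      ((((V t).pow 3).const_mul 4).mul (D 2 (by norm_num) t))).congr_deriv (by
        simp only [Pi.pow_apply]; push_cast; ring))
    (fun t ht => ?_)
  · convert key using 1
    · congr 1; norm_num
    · ring
  · have hv := hv t (abs_le.2 ⟨by linarith [ht.1], ht.2⟩)
    have h1 := hC 1 (by norm_num) (by norm_num) _ (hW t)
    have h2 := hC 2 (by norm_num) (by norm_num) _ (hW t)
    have h3 := hC 3 (by norm_num) (by norm_num) _ (hW t)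
    set v := α + t * β
    set W := w + 2 * t * α + t ^ 2 * β
    calc _ ≤ |6 * β ^ 2 * φ 1 W| + |24 * β * v ^ 2 * φ 2 W| + |8 * v ^ 4 * φ 3 W| := abs_add_three _ _ _
      _ = 6 * β ^ 2 * |φ 1 W| + 24 * β * |v| ^ 2 * |φ 2 W| + 8 * |v| ^ 4 * |φ 3 W| := by
          simp only [abs_mul, abs_pow, abs_of_nonneg hβ0]; norm_num
      _ ≤ 6 * (c ^ 2) ^ 2 * C 1 + 24 * c ^ 2 * (c * y) ^ 2 * C 2 + 8 * (c * y) ^ 4 * C 3 := by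
          gcongr
      _ = _ := by ring

theorem abs_taylor_laguerre_le {A Y : ℝ}
    (hφ : ∀ k ≤ 4, ∀ x, 0 ≤ x → HasDerivAt (φ k) (φ (k + 1) x) x)
    (hC : ∀ k, 1 ≤ k → k ≤ 5 → ∀ x, 0 ≤ x → |φ k x| ≤ C k)
    (hW : ∀ t : ℝ, 0 ≤ w + 2 * t * α + t ^ 2 * β) (hβ0 : 0 ≤ β) (hβ : β ≤ c ^ 2) (hA : 0 ≤ A)
    (hv : ∀ t : ℝ, |t| ≤ 1 → |α + t * β| ≤ c * y)
    (hY : ∀ t : ℝ, |t| ≤ 1 → w + 2 * t * α + t ^ 2 * β ≤ Y) :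
    |(A * φ 0 (w + 2 * α + β) + 2 * (w + 2 * α + β) * φ 1 (w + 2 * α + β))
      - (A * φ 0 w + 2 * w * φ 1 w) - α * (2 * ((A + 2) * φ 1 w + 2 * w * φ 2 w))|
      ≤ c ^ 2 * ((A + 2) * C 1 + 2 * Y * C 2 + 2 * y ^ 2 * (A + 4) * C 2 + 4 * y ^ 2 * Y * C 3) := by
  have D := fun k hk t => hasDerivAt_comp_quadratic (k := k) hφ hW hk t
  have V := hasDerivAt_linear α β
  have hWd : ∀ t : ℝ, HasDerivAt (fun t : ℝ => w + 2 * t * α + t ^ 2 * β) (2 * (α + t * β)) t :=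
    fun t => (((((hasDerivAt_id t).const_mul 2).mul_const α).const_add w).add
      ((hasDerivAt_pow 2 t).mul_const β)).congr_deriv (by push_cast; ring)
  have key := abs_taylor_two_le
    (f := fun t => A * φ 0 (w + 2 * t * α + t ^ 2 * β)
      + 2 * (w + 2 * t * α + t ^ 2 * β) * φ 1 (w + 2 * t * α + t ^ 2 * β))
    (f₁ := fun t => 2 * (α + t * β) * ((A + 2) * φ 1 (w + 2 * t * α + t ^ 2 * β)
      + 2 * (w + 2 * t * α + t ^ 2 * β) * φ 2 (w + 2 * t * α + t ^ 2 * β)))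
    (f₂ := fun t => 2 * β * ((A + 2) * φ 1 (w + 2 * t * α + t ^ 2 * β)
      + 2 * (w + 2 * t * α + t ^ 2 * β) * φ 2 (w + 2 * t * α + t ^ 2 * β))
      + 4 * (α + t * β) ^ 2 * ((A + 4) * φ 2 (w + 2 * t * α + t ^ 2 * β)
      + 2 * (w + 2 * t * α + t ^ 2 * β) * φ 3 (w + 2 * t * α + t ^ 2 * β)))
    (B := 2 * (c ^ 2 * ((A + 2) * C 1 + 2 * Y * C 2 + 2 * y ^ 2 * (A + 4) * C 2
      + 4 * y ^ 2 * Y * C 3)))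
    (fun t _ => (((D 0 (by norm_num) t).const_mul A).add
      (((hWd t).const_mul 2).mul (D 1 (by norm_num) t))).congr_deriv (by ring))
    (fun t _ => (((V t).const_mul 2).mul (((D 1 (by norm_num) t).const_mul (A + 2)).add
      (((hWd t).const_mul 2).mul (D 2 (by norm_num) t)))).congr_deriv (by
        simp only [Pi.add_apply, Pi.mul_apply]; ring))
    (fun t ht => ?_)
  · convert key using 1
    · congr 1; norm_num; ring
    · ring
  · have ht1 : |t| ≤ 1 := abs_le.2 ⟨by linarith [ht.1], ht.2⟩
    have hv := hv t ht1
    have hY := hY t ht1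
    have h0 := hW t
    have h1 := hC 1 (by norm_num) (by norm_num) _ (hW t)
    have h2 := hC 2 (by norm_num) (by norm_num) _ (hW t)
    have h3 := hC 3 (by norm_num) (by norm_num) _ (hW t)
    have hY0 : 0 ≤ Y := h0.trans hY
    have n2 : 0 ≤ C 2 := (abs_nonneg _).trans h2
    have n3 : 0 ≤ C 3 := (abs_nonneg _).trans h3
    set v := α + t * β
    set W := w + 2 * t * α + t ^ 2 * β
    have b : ∀ (a b x z : ℝ), 0 ≤ a → 0 ≤ b → |a * x + b * z| ≤ a * |x| + b * |z| := by
      intro a b x z ha hb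
      refine (abs_add_le _ _).trans ?_
      rw [abs_mul, abs_mul, abs_of_nonneg ha, abs_of_nonneg hb]
    have b1 : |(A + 2) * φ 1 W + 2 * W * φ 2 W| ≤ (A + 2) * C 1 + 2 * Y * C 2 :=
      (b _ _ _ _ (by positivity) (by positivity)).trans (by gcongr)
    have b2 : |(A + 4) * φ 2 W + 2 * W * φ 3 W| ≤ (A + 4) * C 2 + 2 * Y * C 3 :=
      (b _ _ _ _ (by positivity) (by positivity)).trans (by gcongr)
    calc _ ≤ 2 * β * |(A + 2) * φ 1 W + 2 * W * φ 2 W|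
          + 4 * v ^ 2 * |(A + 4) * φ 2 W + 2 * W * φ 3 W| :=
          b _ _ _ _ (by positivity) (by positivity)
      _ ≤ 2 * c ^ 2 * ((A + 2) * C 1 + 2 * Y * C 2)
          + 4 * (c * y) ^ 2 * ((A + 4) * C 2 + 2 * Y * C 3) := by
          have : v ^ 2 ≤ (c * y) ^ 2 := by
            rw [← sq_abs v]; gcongr
          gcongr
      _ = _ := by ring

/-- Symmetric difference of the odd function from the second order term of the expansion; `u + t a`
is the coordinate along the step. Products of powers of `z` and `y` are split by Young type
inequalities, so that only moments of single coordinates are needed. -/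
theorem abs_taylor_cubic_le {u a z : ℝ}
    (hφ : ∀ k ≤ 4, ∀ x, 0 ≤ x → HasDerivAt (φ k) (φ (k + 1) x) x)
    (hC : ∀ k, 1 ≤ k → k ≤ 5 → ∀ x, 0 ≤ x → |φ k x| ≤ C k)
    (hW : ∀ t : ℝ, 0 ≤ w + 2 * t * α + t ^ 2 * β) (hβ0 : 0 ≤ β) (hβ : β ≤ c ^ 2)
    (hv : ∀ t : ℝ, |t| ≤ 1 → |α + t * β| ≤ c * y) (hc : 0 ≤ c) (hy : 0 ≤ y) (ha : |a| ≤ c)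
    (hz : ∀ t : ℝ, |t| ≤ 1 → |u + t * a| ≤ z) :
    |(3 * (u + a) * φ 1 (w + 2 * α + β) + 2 * (u + a) ^ 3 * φ 2 (w + 2 * α + β))
      - (3 * (u - a) * φ 1 (w - 2 * α + β) + 2 * (u - a) ^ 3 * φ 2 (w - 2 * α + β))
      - (a * (6 * φ 1 w + 12 * u ^ 2 * φ 2 w) + α * (12 * u * φ 2 w + 8 * u ^ 3 * φ 3 w))|
      ≤ c ^ 3 / 3 * (30 * C 2 + 90 * (z ^ 2 + y ^ 2) * C 3 + 60 * (z ^ 4 + y ^ 4) * C 4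
        + 8 * (z ^ 6 + y ^ 6) * C 5) := by
  have D := fun k hk t => hasDerivAt_comp_quadratic (k := k) hφ hW hk t
  have V := hasDerivAt_linear α β
  have U := hasDerivAt_linear u a
  have key := abs_taylor_odd_le
    (f := fun t => 3 * (u + t * a) * φ 1 (w + 2 * t * α + t ^ 2 * β)
      + 2 * (u + t * a) ^ 3 * φ 2 (w + 2 * t * α + t ^ 2 * β))
    (f₁ := fun t => 3 * a * φ 1 (w + 2 * t * α + t ^ 2 * β)
      + (6 * (u + t * a) * (α + t * β) + 6 * a * (u + t * a) ^ 2)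
        * φ 2 (w + 2 * t * α + t ^ 2 * β)
      + 4 * (u + t * a) ^ 3 * (α + t * β) * φ 3 (w + 2 * t * α + t ^ 2 * β))
    (f₂ := fun t => (12 * a * (α + t * β) + 6 * (u + t * a) * β + 12 * a ^ 2 * (u + t * a))
        * φ 2 (w + 2 * t * α + t ^ 2 * β)
      + (12 * (u + t * a) * (α + t * β) ^ 2 + 24 * a * (u + t * a) ^ 2 * (α + t * β)
        + 4 * (u + t * a) ^ 3 * β) * φ 3 (w + 2 * t * α + t ^ 2 * β)
      + 8 * (u + t * a) ^ 3 * (α + t * β) ^ 2 * φ 4 (w + 2 * t * α + t ^ 2 * β))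
    (f₃ := fun t => (18 * a * β + 12 * a ^ 3) * φ 2 (w + 2 * t * α + t ^ 2 * β)
      + (36 * a * (α + t * β) ^ 2 + 36 * β * ((u + t * a) * (α + t * β))
        + 72 * a ^ 2 * ((u + t * a) * (α + t * β)) + 36 * a * β * (u + t * a) ^ 2)
        * φ 3 (w + 2 * t * α + t ^ 2 * β)
      + (24 * ((u + t * a) * (α + t * β) ^ 3) + 72 * a * ((u + t * a) ^ 2 * (α + t * β) ^ 2)
        + 24 * β * ((u + t * a) ^ 3 * (α + t * β))) * φ 4 (w + 2 * t * α + t ^ 2 * β)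
      + 16 * ((u + t * a) ^ 3 * (α + t * β) ^ 3) * φ 5 (w + 2 * t * α + t ^ 2 * β))
    (B := c ^ 3 * (30 * C 2 + 90 * (z ^ 2 + y ^ 2) * C 3 + 60 * (z ^ 4 + y ^ 4) * C 4
        + 8 * (z ^ 6 + y ^ 6) * C 5))
    (fun t _ => ((((U t).const_mul 3).mul (D 1 (by norm_num) t)).add
      ((((U t).pow 3).const_mul 2).mul (D 2 (by norm_num) t))).congr_deriv (by
        simp only [Pi.pow_apply]; push_cast; ring))
    (fun t _ => ((((D 1 (by norm_num) t).const_mul (3 * a)).add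
      (((((U t).const_mul 6).mul (V t)).add (((U t).pow 2).const_mul (6 * a))).mul
        (D 2 (by norm_num) t))).add
      (((((U t).pow 3).const_mul 4).mul (V t)).mul (D 3 (by norm_num) t))).congr_deriv (by
        simp only [Pi.pow_apply, Pi.add_apply, Pi.mul_apply]; push_cast; ring))
    (fun t _ => ((((((V t).const_mul (12 * a)).add (((U t).const_mul 6).mul_const β)).add
        ((U t).const_mul (12 * a ^ 2))).mul (D 2 (by norm_num) t)).add
      ((((((U t).const_mul 12).mul ((V t).pow 2)).add
        ((((U t).pow 2).const_mul (24 * a)).mul (V t))).add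
        ((((U t).pow 3).const_mul 4).mul_const β)).mul (D 3 (by norm_num) t)) |>.add
      (((((U t).pow 3).const_mul 8).mul ((V t).pow 2)).mul (D 4 (by norm_num) t))).congr_deriv (by
        simp only [Pi.pow_apply, Pi.add_apply, Pi.mul_apply]; push_cast; ring))
    (fun t ht => ?_)
  · convert key using 1
    · congr 1; norm_num; ring_nf
    · ring
  · have ht1 : |t| ≤ 1 := abs_le.2 ht
    have hv := hv t ht1
    have hz := hz t ht1
    have h2 := hC 2 (by norm_num) (by norm_num) _ (hW t)
    have h3 := hC 3 (by norm_num) (by norm_num) _ (hW t)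
    have h4 := hC 4 (by norm_num) (by norm_num) _ (hW t)
    have h5 := hC 5 (by norm_num) (by norm_num) _ (hW t)
    have n3 : 0 ≤ C 3 := (abs_nonneg _).trans h3
    have n4 : 0 ≤ C 4 := (abs_nonneg _).trans h4
    have n5 : 0 ≤ C 5 := (abs_nonneg _).trans h5
    have hz0 : 0 ≤ z := (abs_nonneg _).trans hz
    set v := α + t * β
    set u' := u + t * a
    set W := w + 2 * t * α + t ^ 2 * β
    have a2 : |18 * a * β + 12 * a ^ 3| ≤ c ^ 3 * 30 := by
      calc _ ≤ |18 * a * β| + |12 * a ^ 3| := abs_add_le _ _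
        _ = 18 * |a| * β + 12 * |a| ^ 3 := by
          simp only [abs_mul, abs_pow, abs_of_nonneg hβ0]; norm_num
        _ ≤ 18 * c * c ^ 2 + 12 * c ^ 3 := by gcongr
        _ = _ := by ring
    have a3 : |36 * a * v ^ 2 + 36 * β * (u' * v) + 72 * a ^ 2 * (u' * v) + 36 * a * β * u' ^ 2|
        ≤ c ^ 3 * (90 * (z ^ 2 + y ^ 2)) := by
      calc _ ≤ |36 * a * v ^ 2| + |36 * β * (u' * v)| + |72 * a ^ 2 * (u' * v)|
            + |36 * a * β * u' ^ 2| :=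
            (abs_add_le _ _).trans (by gcongr; exact abs_add_three _ _ _)
        _ = 36 * |a| * |v| ^ 2 + 36 * β * (|u'| * |v|) + 72 * |a| ^ 2 * (|u'| * |v|)
            + 36 * |a| * β * |u'| ^ 2 := by
          simp only [abs_mul, abs_pow, abs_of_nonneg hβ0]; norm_num
        _ ≤ 36 * c * (c * y) ^ 2 + 36 * c ^ 2 * (z * (c * y)) + 72 * c ^ 2 * (z * (c * y))
            + 36 * c * c ^ 2 * z ^ 2 := by gcongr
        _ = c ^ 3 * (36 * y ^ 2 + 108 * (z * y) + 36 * z ^ 2) := by ring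
        _ ≤ _ := by gcongr; nlinarith [sq_nonneg (z - y)]
    have a4 : |24 * (u' * v ^ 3) + 72 * a * (u' ^ 2 * v ^ 2) + 24 * β * (u' ^ 3 * v)|
        ≤ c ^ 3 * (60 * (z ^ 4 + y ^ 4)) := by
      calc _ ≤ |24 * (u' * v ^ 3)| + |72 * a * (u' ^ 2 * v ^ 2)| + |24 * β * (u' ^ 3 * v)| :=
            abs_add_three _ _ _
        _ = 24 * (|u'| * |v| ^ 3) + 72 * |a| * (|u'| ^ 2 * |v| ^ 2) + 24 * β * (|u'| ^ 3 * |v|) := by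
          simp only [abs_mul, abs_pow, abs_of_nonneg hβ0]; norm_num
        _ ≤ 24 * (z * (c * y) ^ 3) + 72 * c * (z ^ 2 * (c * y) ^ 2)
            + 24 * c ^ 2 * (z ^ 3 * (c * y)) := by gcongr
        _ = c ^ 3 * (24 * (z * y ^ 3 + z ^ 3 * y) + 72 * (z ^ 2 * y ^ 2)) := by ring
        _ ≤ _ := by
          gcongr
          have e1 : 0 ≤ (z - y) ^ 2 * (z ^ 2 + z * y + y ^ 2) := by positivity
          nlinarith [sq_nonneg (z ^ 2 - y ^ 2)]
    have a5 : |16 * (u' ^ 3 * v ^ 3)| ≤ c ^ 3 * (8 * (z ^ 6 + y ^ 6)) := by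
      calc _ = 16 * (|u'| ^ 3 * |v| ^ 3) := by
            simp only [abs_mul, abs_pow]; norm_num
        _ ≤ 16 * (z ^ 3 * (c * y) ^ 3) := by gcongr
        _ = c ^ 3 * (16 * (z ^ 3 * y ^ 3)) := by ring
        _ ≤ _ := by
          refine mul_le_mul_of_nonneg_left ?_ (by positivity)
          nlinarith [sq_nonneg (z ^ 3 - y ^ 3)]
    calc _ ≤ |(18 * a * β + 12 * a ^ 3) * φ 2 W|
          + |(36 * a * v ^ 2 + 36 * β * (u' * v) + 72 * a ^ 2 * (u' * v) + 36 * a * β * u' ^ 2)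
            * φ 3 W|
          + |(24 * (u' * v ^ 3) + 72 * a * (u' ^ 2 * v ^ 2) + 24 * β * (u' ^ 3 * v)) * φ 4 W|
          + |16 * (u' ^ 3 * v ^ 3) * φ 5 W| :=
          (abs_add_le _ _).trans (by gcongr; exact abs_add_three _ _ _)
      _ ≤ c ^ 3 * 30 * C 2 + c ^ 3 * (90 * (z ^ 2 + y ^ 2)) * C 3
          + c ^ 3 * (60 * (z ^ 4 + y ^ 4)) * C 4 + c ^ 3 * (8 * (z ^ 6 + y ^ 6)) * C 5 := by
          simp only [abs_mul _ (φ _ _)]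
          gcongr
      _ = _ := by ring

end Quadratic

/-! ### Linearity of the walk expectation -/

section WalkLinear

variable {ι J : Type*} [Fintype ι] {ξ : ι → J → ℝ} {p : ι → ℝ} (a b : ℕ)

theorem walkE_add (F G : (J → ℝ) → ℝ) :
    walkE ξ p a b (fun s => F s + G s) = walkE ξ p a b F + walkE ξ p a b G := map_add _ F G

theorem walkE_sub (F G : (J → ℝ) → ℝ) :
    walkE ξ p a b (fun s => F s - G s) = walkE ξ p a b F - walkE ξ p a b G := map_sub _ F G

theorem walkE_const_mul (c : ℝ) (F : (J → ℝ) → ℝ) :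
    walkE ξ p a b (fun s => c * F s) = c * walkE ξ p a b F := map_smul _ c F

theorem walkE_sum {κ : Type*} (t : Finset κ) (F : κ → (J → ℝ) → ℝ) :
    walkE ξ p a b (fun s => ∑ k ∈ t, F k s) = ∑ k ∈ t, walkE ξ p a b (F k) := by
  rw [← map_sum]
  congr 1
  funext s
  rw [Finset.sum_apply]

end WalkLinear

/-! ### Geometry of the standardized multinomial steps -/

variable {m : ℕ}

/-- The standardized contribution to the counts of a trial which leads to class `k`. -/
def cellStep (n : ℕ) (p : Fin m → ℝ) (k j : Fin m) : ℝ :=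
  ((if k = j then 1 / √(p j) else 0) - √(p j)) / √n

/-- The scale `1 / √(n p_k)` of the `k`-th count. -/
def cellScale (n : ℕ) (p : Fin m → ℝ) (k : Fin m) : ℝ := 1 / √(n * p k)

/-- The hyperplane in which the standardized counts live. -/
def OnHyperplane (p s : Fin m → ℝ) : Prop := ∑ j, √(p j) * s j = 0

/-- The square of the Euclidean norm. -/
def normSq (s : Fin m → ℝ) : ℝ := ∑ j, s j ^ 2

section Cell

variable {n : ℕ} {p : Fin m → ℝ}

theorem normSq_nonneg (s : Fin m → ℝ) : 0 ≤ normSq s := Finset.sum_nonneg fun _ _ => sq_nonneg _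

theorem normSq_neg (s : Fin m → ℝ) : normSq (-s) = normSq s := by
  simp [normSq]

theorem pos_of_one_le_mul (hnp : ∀ j, 1 ≤ (n : ℝ) * p j) (j : Fin m) : 0 < p j := by
  have h1 := hnp j
  by_contra hcon
  have : (n : ℝ) * p j ≤ 0 := mul_nonpos_of_nonneg_of_nonpos (Nat.cast_nonneg n) (not_lt.1 hcon)
  linarith

theorem cellScale_pos (hnp : ∀ j, 1 ≤ (n : ℝ) * p j) (k : Fin m) : 0 < cellScale n p k := by
  have : 0 < (n : ℝ) * p k := by linarith [hnp k]
  unfold cellScale; positivity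

theorem cellScale_le_one (hnp : ∀ j, 1 ≤ (n : ℝ) * p j) (k : Fin m) : cellScale n p k ≤ 1 := by
  have h1 : 1 ≤ √(n * p k) := Real.one_le_sqrt.2 (hnp k)
  exact (div_le_one (by linarith)).2 h1

theorem mul_cellScale_sq (hnp : ∀ j, 1 ≤ (n : ℝ) * p j) (k : Fin m) :
    n * p k * cellScale n p k ^ 2 = 1 := by
  have : 0 < (n : ℝ) * p k := by linarith [hnp k]
  rw [cellScale, div_pow, Real.sq_sqrt this.le, one_pow, mul_one_div, div_self this.ne']

theorem le_one_of_sum_eq_one (hp : ∀ k, 0 < p k) (hp1 : ∑ k, p k = 1) (k : Fin m) : p k ≤ 1 := by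
  rw [← hp1]
  exact Finset.single_le_sum (fun j _ => (hp j).le) (Finset.mem_univ k)

/-- The bound depends on the class `k` reached, not on the coordinate `j`: off the diagonal, `√(p j)
≤ 1 ≤ 1 / √(p k)`. -/
theorem abs_cellStep_le (hn : 0 < n) (hp : ∀ k, 0 < p k) (hp1 : ∑ k, p k = 1) (k j : Fin m) :
    |cellStep n p k j| ≤ cellScale n p k := by
  have hn' : (0 : ℝ) < √n := Real.sqrt_pos.2 (by exact_mod_cast hn)
  have hk := Real.sqrt_pos.2 (hp k)
  have hj := Real.sqrt_pos.2 (hp j)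
  have hk1 : √(p k) ≤ 1 := Real.sqrt_le_one.2 (le_one_of_sum_eq_one hp hp1 k)
  have hj1 : √(p j) ≤ 1 := Real.sqrt_le_one.2 (le_one_of_sum_eq_one hp hp1 j)
  have hinv : 1 ≤ 1 / √(p k) := (one_le_div hk).2 hk1
  have e : cellScale n p k = 1 / √(p k) / √n := by
    rw [cellScale, Real.sqrt_mul (Nat.cast_nonneg n), div_div, mul_comm]
  rw [e, cellStep, abs_div, abs_of_pos hn']
  gcongr
  split_ifs with h
  · subst h
    rw [abs_of_nonneg (by linarith)]; linarith
  · rw [zero_sub, abs_neg, abs_of_pos hj]; linarith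

theorem sum_mul_cellStep (hp1 : ∑ k, p k = 1) (j : Fin m) :
    ∑ k, p k * cellStep n p k j = 0 := by
  have : ∀ k, p k * cellStep n p k j = ((if k = j then p k / √(p j) else 0) - p k * √(p j)) / √n := by
    intro k
    unfold cellStep
    split_ifs <;> ring
  rw [Finset.sum_congr rfl fun k _ => this k, ← Finset.sum_div, Finset.sum_sub_distrib,
    ← Finset.sum_mul, hp1, Finset.sum_ite_eq' Finset.univ j, if_pos (Finset.mem_univ j),
    Real.div_sqrt, one_mul, sub_self, zero_div]

theorem sum_mul_cellStep_sq_le (hp : ∀ k, 0 < p k) (hp1 : ∑ k, p k = 1) (j : Fin m) :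
    ∑ k, p k * cellStep n p k j ^ 2 ≤ 1 / n := by
  have hj := Real.sqrt_pos.2 (hp j)
  have : ∀ k, p k * cellStep n p k j ^ 2
      = ((if k = j then p k / p j - 2 * p k else 0) + p k * p j) / n := by
    intro k
    have h1 := Real.sq_sqrt (hp j).le
    have h2 : √(n : ℝ) ^ 2 = n := Real.sq_sqrt (Nat.cast_nonneg n)
    unfold cellStep
    rw [div_pow, h2]
    have e : (1 / √(p j) - √(p j)) ^ 2 = 1 / p j - 2 + p j := by
      rw [sub_sq, div_pow, one_pow, h1]; field_simp
    split_ifs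
    · rw [e]; ring
    · rw [zero_sub, neg_sq, h1]; ring
  rw [Finset.sum_congr rfl fun k _ => this k, ← Finset.sum_div, Finset.sum_add_distrib,
    ← Finset.sum_mul, hp1, Finset.sum_ite_eq' Finset.univ j, if_pos (Finset.mem_univ j),
    div_self (hp j).ne']
  gcongr
  linarith [hp j]

/-- The step is a multiple of a basis vector minus a multiple of the normal of the hyperplane, and
the normal part is invisible on the hyperplane. Hence a step into class `k` affects the squared norm
only through the coordinate `s k`. -/
theorem cellStep_inner {s : Fin m → ℝ} (hs : OnHyperplane p s)
    (k : Fin m) : ∑ j, cellStep n p k j * s j = cellScale n p k * s k := by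
  have : ∀ j, cellStep n p k j * s j
      = ((if k = j then s j / √(p j) else 0) - √(p j) * s j) / √n := by
    intro j; unfold cellStep; split_ifs <;> ring
  rw [Finset.sum_congr rfl fun j _ => this j, ← Finset.sum_div, Finset.sum_sub_distrib, hs,
    Finset.sum_ite_eq Finset.univ k, if_pos (Finset.mem_univ k), cellScale,
    Real.sqrt_mul (Nat.cast_nonneg n), sub_zero, div_div, mul_comm (√(p k))]
  ring

theorem onHyperplane_cellStep (hp : ∀ k, 0 < p k) (hp1 : ∑ k, p k = 1) (k : Fin m) :
    OnHyperplane p (cellStep n p k) := by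
  have : ∀ j, √(p j) * cellStep n p k j = ((if k = j then 1 else 0) - p j) / √n := by
    intro j
    have h1 := Real.mul_self_sqrt (hp j).le
    have h2 := (Real.sqrt_pos.2 (hp j)).ne'
    unfold cellStep
    split_ifs
    · rw [mul_div_assoc', mul_sub, h1]; field_simp
    · rw [mul_div_assoc', mul_sub, h1, mul_zero]
  rw [OnHyperplane, Finset.sum_congr rfl fun j _ => this j, ← Finset.sum_div,
    Finset.sum_sub_distrib, hp1]
  simp

theorem OnHyperplane.add_smul_cellStep (hp : ∀ k, 0 < p k) (hp1 : ∑ k, p k = 1)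
    (s : Fin m → ℝ) (k : Fin m) (ε : ℝ) (hs : OnHyperplane p s) :
    OnHyperplane p (s + ε • cellStep n p k) := by
  have h2 := onHyperplane_cellStep (n := n) hp hp1 k
  unfold OnHyperplane at *
  simp only [Pi.add_apply, Pi.smul_apply, smul_eq_mul, mul_add, Finset.sum_add_distrib, hs,
    mul_left_comm _ ε, ← Finset.mul_sum, h2, mul_zero, add_zero]

theorem onHyperplane_zero : OnHyperplane p 0 := by simp [OnHyperplane]

theorem normSq_cellStep (hnp : ∀ j, 1 ≤ (n : ℝ) * p j) (hp1 : ∑ k, p k = 1) (k : Fin m) :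
    normSq (cellStep n p k) = cellScale n p k ^ 2 - 1 / n := by
  have hp := pos_of_one_le_mul hnp
  have h1 := cellStep_inner (n := n) (onHyperplane_cellStep (n := n) hp hp1 k) k
  have hk := Real.sqrt_pos.2 (hp k)
  have e : cellScale n p k = 1 / √(p k) / √n := by
    rw [cellScale, Real.sqrt_mul (Nat.cast_nonneg n), div_div, mul_comm]
  have h2 : √(n : ℝ) * √n = n := Real.mul_self_sqrt (Nat.cast_nonneg n)
  have e2 : normSq (cellStep n p k) = ∑ j, cellStep n p k j * cellStep n p k j :=
    Finset.sum_congr rfl fun j _ => sq _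
  rw [e2, h1]
  have e3 : cellStep n p k k = cellScale n p k - √(p k) / √n := by
    rw [e, cellStep, if_pos rfl, sub_div]
  have e4 : cellScale n p k * (√(p k) / √n) = 1 / n := by
    have : 1 / (n : ℝ) = 1 / (√n * √n) := by rw [h2]
    rw [e, this]; field_simp
  rw [e3, mul_sub, e4, sq]

theorem normSq_add_smul {s : Fin m → ℝ}
    (hs : OnHyperplane p s) (k : Fin m) (t : ℝ) :
    normSq (s + t • cellStep n p k)
      = normSq s + 2 * t * (cellScale n p k * s k) + t ^ 2 * normSq (cellStep n p k) := by
  rw [← cellStep_inner hs k]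
  simp only [normSq, Pi.add_apply, Pi.smul_apply, smul_eq_mul, Finset.mul_sum,
    ← Finset.sum_add_distrib]
  exact Finset.sum_congr rfl fun j _ => by ring

theorem sum_mul_cellScale_mul (hp1 : ∑ k, p k = 1)
    {s : Fin m → ℝ} (hs : OnHyperplane p s) : ∑ k, p k * (cellScale n p k * s k) = 0 := by
  simp only [← cellStep_inner hs, Finset.mul_sum]
  rw [Finset.sum_comm]
  simp only [← mul_assoc, ← Finset.sum_mul, sum_mul_cellStep hp1,
    zero_mul, Finset.sum_const_zero]

/-- Each scale is at least `1 / √n` because `p k ≤ 1`; this absorbs errors of order `m² / n` into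
the final bound. -/
theorem sq_le_mul_sum_cellScale_sq (hn : 0 < n) (hnp : ∀ j, 1 ≤ (n : ℝ) * p j)
    (hp1 : ∑ k, p k = 1) : (m : ℝ) ^ 2 / n ≤ (∑ k, cellScale n p k) ^ 2 := by
  have hp := pos_of_one_le_mul hnp
  have hn' : (0 : ℝ) < n := by exact_mod_cast hn
  have h1 : ∀ k, 1 / √n ≤ cellScale n p k := by
    intro k
    have : 0 < (n : ℝ) * p k := by linarith [hnp k]
    unfold cellScale
    gcongr
    exact mul_le_of_le_one_right hn'.le (le_one_of_sum_eq_one hp hp1 k)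
  have h2 : m * (1 / √n) ≤ ∑ k, cellScale n p k := by
    have := Finset.card_nsmul_le_sum Finset.univ (cellScale n p) _ fun k _ => h1 k
    simpa using this
  calc (m : ℝ) ^ 2 / n = (m * (1 / √n)) ^ 2 := by
        rw [mul_pow, div_pow, Real.sq_sqrt hn'.le]; ring
    _ ≤ _ := by gcongr

theorem sum_cellScale (n : ℕ) (p : Fin m → ℝ) :
    ∑ k, cellScale n p k = (∑ k, 1 / √(p k)) / √n := by
  rw [Finset.sum_div]
  refine Finset.sum_congr rfl fun k _ => ?_
  rw [cellScale, Real.sqrt_mul (Nat.cast_nonneg n), div_div, mul_comm]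

theorem increment_nonneg {s : Fin m → ℝ} (hs : OnHyperplane p s) (k : Fin m) (t : ℝ) :
    0 ≤ normSq s + 2 * t * (cellScale n p k * s k) + t ^ 2 * normSq (cellStep n p k) := by
  rw [← normSq_add_smul hs]; exact normSq_nonneg _

section Increment

variable (hn : 0 < n) (hnp : ∀ j, 1 ≤ (n : ℝ) * p j) (hp1 : ∑ k, p k = 1) {s : Fin m → ℝ}
  (hs : OnHyperplane p s) (k : Fin m) {t : ℝ} (ht : |t| ≤ 1)
include hnp

theorem normSq_cellStep_le (hp1 : ∑ k, p k = 1) :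
    normSq (cellStep n p k) ≤ cellScale n p k ^ 2 := by
  rw [normSq_cellStep hnp hp1]
  have : (0 : ℝ) ≤ 1 / n := by positivity
  linarith

include hp1 ht in
-- The quadratic part is at most `cellScale n p k ^ 2`, hence at most `cellScale n p k`, as the
-- scale does not exceed `1`. This is why moments of `1 + |s k|` appear.
theorem abs_increment_inner_le :
    |cellScale n p k * s k + t * normSq (cellStep n p k)| ≤ cellScale n p k * (1 + |s k|) := by
  have hc := cellScale_pos hnp k
  have hc1 := cellScale_le_one hnp k
  have hb := normSq_cellStep_le hnp k hp1
  have hb0 := normSq_nonneg (cellStep n p k)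
  calc _ ≤ |cellScale n p k * s k| + |t * normSq (cellStep n p k)| := abs_add_le _ _
    _ = cellScale n p k * |s k| + |t| * normSq (cellStep n p k) := by
      rw [abs_mul, abs_mul, abs_of_pos hc, abs_of_nonneg hb0]
    _ ≤ cellScale n p k * |s k| + 1 * (cellScale n p k * 1) := by
      gcongr
      refine hb.trans ?_
      rw [sq]; gcongr
    _ = _ := by ring

include hn hp1 ht in
theorem abs_add_mul_cellStep_le (j : Fin m) : |s j + t * cellStep n p k j| ≤ 1 + |s j| := by
  have h1 := abs_cellStep_le hn (pos_of_one_le_mul hnp) hp1 k j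
  have h2 := cellScale_le_one hnp k
  calc _ ≤ |s j| + |t| * |cellStep n p k j| := by rw [← abs_mul]; exact abs_add_le _ _
    _ ≤ |s j| + 1 * 1 := by gcongr; exact h1.trans h2
    _ = _ := by ring

include hn hp1 hs ht in
theorem increment_le : normSq s + 2 * t * (cellScale n p k * s k)
    + t ^ 2 * normSq (cellStep n p k) ≤ ∑ j, (1 + |s j|) ^ 2 := by
  rw [← normSq_add_smul hs]
  refine Finset.sum_le_sum fun j _ => ?_
  rw [← sq_abs]
  gcongr
  exact abs_add_mul_cellStep_le hn hnp hp1 k ht j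

end Increment

end Cell

/-! ### Expectation of the Stein operator along the walk -/

section SteinExpectation

variable {m n : ℕ} {p : Fin m → ℝ} {φ : ℕ → ℝ → ℝ} {C : ℕ → ℝ}
  (hn : 0 < n) (hnp : ∀ j, 1 ≤ (n : ℝ) * p j) (hp1 : ∑ k, p k = 1)

include hnp hp1

theorem abs_walk_le {a b : ℕ} {F G : (Fin m → ℝ) → ℝ}
    (hFG : ∀ s, OnHyperplane p s → |F s| ≤ G s) :
    |walkE (cellStep n p) p a b F| ≤ walkE (cellStep n p) p a b G :=
  have hp := pos_of_one_le_mul hnp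
  abs_walkE_le (fun k => (hp k).le) (OnHyperplane.add_smul_cellStep hp hp1) onHyperplane_zero a b hFG

theorem walk_congr {a b : ℕ} {F G : (Fin m → ℝ) → ℝ}
    (hFG : ∀ s, OnHyperplane p s → F s = G s) :
    walkE (cellStep n p) p a b F = walkE (cellStep n p) p a b G :=
  have hp := pos_of_one_le_mul hnp
  walkE_congr (fun k => (hp k).le) (OnHyperplane.add_smul_cellStep hp hp1) onHyperplane_zero a b hFG

include hn

theorem walk_moment_two_le {a b : ℕ} (hab : a + b ≤ n) (j : Fin m) :
    walkE (cellStep n p) p a b (fun s => (1 + |s j|) ^ 2) ≤ 8 :=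
  have hp := pos_of_one_le_mul hnp
  walkE_one_add_abs_sq_le hn (fun k => (hp k).le) hp1 (sum_mul_cellStep hp1 j)
    (sum_mul_cellStep_sq_le hp hp1 j)
    (fun k => (abs_cellStep_le hn hp hp1 k j).trans (cellScale_le_one hnp k)) hab

theorem walk_moment_four_le {a b : ℕ} (hab : a + b ≤ n) (j : Fin m) :
    walkE (cellStep n p) p a b (fun s => (1 + |s j|) ^ 4) ≤ 70 :=
  have hp := pos_of_one_le_mul hnp
  walkE_one_add_abs_pow_four_le hn (fun k => (hp k).le) hp1 (sum_mul_cellStep hp1 j)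
    (sum_mul_cellStep_sq_le hp hp1 j)
    (fun k => (abs_cellStep_le hn hp hp1 k j).trans (cellScale_le_one hnp k)) hab

theorem walk_moment_six_le {a b : ℕ} (hab : a + b ≤ n) (j : Fin m) :
    walkE (cellStep n p) p a b (fun s => (1 + |s j|) ^ 6) ≤ 1800 :=
  have hp := pos_of_one_le_mul hnp
  walkE_one_add_abs_pow_six_le hn (fun k => (hp k).le) hp1 (sum_mul_cellStep hp1 j)
    (sum_mul_cellStep_sq_le hp hp1 j)
    (fun k => (abs_cellStep_le hn hp hp1 k j).trans (cellScale_le_one hnp k)) hab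

variable (hφ : ∀ k ≤ 4, ∀ x, 0 ≤ x → HasDerivAt (φ k) (φ (k + 1) x) x)
  (hC : ∀ k, 1 ≤ k → k ≤ 5 → ∀ x, 0 ≤ x → |φ k x| ≤ C k)
include hφ hC

omit hn hnp hp1 hφ in
theorem bound_nonneg {k : ℕ} (h1 : 1 ≤ k) (h5 : k ≤ 5) : 0 ≤ C k :=
  (abs_nonneg _).trans (hC k h1 h5 0 le_rfl)

/-- The expectations of the odd functions which represent the third order terms are small. -/
theorem abs_walk_odd_le {N : ℕ} (hN : N ≤ n) (j : Fin m) :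
    |walkE (cellStep n p) p N 0
      (fun s => 3 * s j * φ 1 (normSq s) + 2 * s j ^ 3 * φ 2 (normSq s))|
      ≤ (∑ k, cellScale n p k) / 6 * (30 * C 2 + 1440 * C 3 + 8400 * C 4 + 28800 * C 5) := by
  have hp := pos_of_one_le_mul hnp
  set g : (Fin m → ℝ) → ℝ := fun s => 3 * s j * φ 1 (normSq s) + 2 * s j ^ 3 * φ 2 (normSq s) with hg
  set M := 30 * C 2 + 1440 * C 3 + 8400 * C 4 + 28800 * C 5 with hM
  have n2 := bound_nonneg hC (k := 2) (by norm_num) (by norm_num)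
  have n3 := bound_nonneg hC (k := 3) (by norm_num) (by norm_num)
  have n4 := bound_nonneg hC (k := 4) (by norm_num) (by norm_num)
  have n5 := bound_nonneg hC (k := 5) (by norm_num) (by norm_num)
  have hodd : ∀ s, g (-s) = -g s := by
    intro s
    simp only [hg, normSq_neg, Pi.neg_apply]; ring
  have hpt : ∀ s, OnHyperplane p s →
      |(shiftOp (cellStep n p) p 1 g - shiftOp (cellStep n p) p (-1) g) s|
      ≤ ∑ k, p k * cellScale n p k ^ 3 / 3 * (30 * C 2
        + 90 * C 3 * ((1 + |s j|) ^ 2 + (1 + |s k|) ^ 2)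
        + 60 * C 4 * ((1 + |s j|) ^ 4 + (1 + |s k|) ^ 4)
        + 8 * C 5 * ((1 + |s j|) ^ 6 + (1 + |s k|) ^ 6)) := by
    intro s hs
    -- The first order part of the symmetric difference. Its average over the step vanishes, since
    -- the step has mean zero and so has its inner product with `s`.
    set L : Fin m → ℝ := fun k =>
      cellStep n p k j * (6 * φ 1 (normSq s) + 12 * s j ^ 2 * φ 2 (normSq s))
      + (cellScale n p k * s k) * (12 * s j * φ 2 (normSq s) + 8 * s j ^ 3 * φ 3 (normSq s)) with hL
    have hL0 : ∑ k, p k * L k = 0 := by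
      simp only [hL, mul_add, ← mul_assoc, Finset.sum_add_distrib]
      simp only [mul_assoc (p _) (cellScale n p _), ← Finset.sum_mul, sum_mul_cellStep hp1 j,
        sum_mul_cellScale_mul hp1 hs, zero_mul, add_zero]
    have e : (shiftOp (cellStep n p) p 1 g - shiftOp (cellStep n p) p (-1) g) s
        = ∑ k, p k * (g (s + (1 : ℝ) • cellStep n p k) - g (s + (-1 : ℝ) • cellStep n p k) - L k) := by
      simp only [mul_sub, Finset.sum_sub_distrib, hL0, sub_zero]
      rfl
    rw [e]
    refine (Finset.abs_sum_le_sum_abs _ _).trans (Finset.sum_le_sum fun k _ => ?_)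
    rw [abs_mul, abs_of_pos (hp k), mul_div_assoc, mul_assoc]
    refine mul_le_mul_of_nonneg_left ?_ (hp k).le
    have key := abs_taylor_cubic_le (w := normSq s) (α := cellScale n p k * s k)
      (β := normSq (cellStep n p k)) (c := cellScale n p k) (y := 1 + |s k|) (u := s j)
      (a := cellStep n p k j) (z := 1 + |s j|) hφ hC (increment_nonneg hs k)
      (normSq_nonneg _) (normSq_cellStep_le hnp k hp1)
      (fun t ht => abs_increment_inner_le hnp hp1 k ht) (cellScale_pos hnp k).le (by positivity)
      (abs_cellStep_le hn hp hp1 k j) (fun t ht => abs_add_mul_cellStep_le hn hnp hp1 k ht j)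
    refine le_of_eq_of_le ?_ (key.trans_eq ?_)
    · simp only [hg, normSq_add_smul hs, Pi.add_apply, Pi.smul_apply, smul_eq_mul, hL]
      congr 1; norm_num; ring_nf
    · ring
  have hstep : ∀ i ∈ Finset.range N, |walkE (cellStep n p) p i (N - 1 - i)
      (shiftOp (cellStep n p) p 1 g - shiftOp (cellStep n p) p (-1) g)|
      ≤ ∑ k, p k * cellScale n p k ^ 3 / 3 * M := by
    intro i hi
    have hi := Finset.mem_range.1 hi
    have hab : i + (N - 1 - i) ≤ n := by omega
    refine (abs_walk_le hnp hp1 hpt).trans ?_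
    rw [walkE_sum]
    refine Finset.sum_le_sum fun k _ => ?_
    have hk := hp k
    have hc := cellScale_pos hnp k
    rw [walkE_const_mul]
    refine mul_le_mul_of_nonneg_left ?_ (by positivity)
    rw [walkE_add, walkE_add, walkE_add, walkE_const hp1, walkE_const_mul, walkE_const_mul,
      walkE_const_mul, walkE_add, walkE_add, walkE_add]
    have a2 := walk_moment_two_le hn hnp hp1 hab
    have a4 := walk_moment_four_le hn hnp hp1 hab
    have a6 := walk_moment_six_le hn hnp hp1 hab
    calc _ ≤ 30 * C 2 + 90 * C 3 * (8 + 8) + 60 * C 4 * (70 + 70) + 8 * C 5 * (1800 + 1800) := by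
          gcongr <;> solve_by_elim
      _ = M := by rw [hM]; ring
  rw [walkE_eq_half_of_odd N hodd, abs_div, abs_two]
  have hM0 : 0 ≤ M := by positivity
  have hS0 : 0 ≤ ∑ k, p k * cellScale n p k ^ 3 / 3 * M := Finset.sum_nonneg fun k _ => by
    have hk := hp k
    have hc := cellScale_pos hnp k
    positivity
  calc _ ≤ (∑ i ∈ Finset.range N, ∑ k, p k * cellScale n p k ^ 3 / 3 * M) / 2 := by
        gcongr
        exact (Finset.abs_sum_le_sum_abs _ _).trans (Finset.sum_le_sum hstep)
    _ = (N : ℝ) * (∑ k, p k * cellScale n p k ^ 3 / 3 * M) / 2 := by simp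
    _ ≤ (n : ℝ) * (∑ k, p k * cellScale n p k ^ 3 / 3 * M) / 2 := by gcongr
    -- Since `n p_k c_k² = 1`, the `n` reversals of size `∑ p_k c_k³` add up to order `∑ c_k`.
    _ = (∑ k, n * p k * cellScale n p k ^ 2 * cellScale n p k) / 6 * M := by
        rw [Finset.mul_sum, Finset.sum_div, Finset.sum_div, Finset.sum_mul]
        exact Finset.sum_congr rfl fun k _ => by ring
    _ = _ := by simp only [mul_cellScale_sq hnp, one_mul]

/-- The effect of one more step on the expectation of the leading term. -/
theorem abs_walk_succ_sub_le {N : ℕ} (hN : N ≤ n) {A : ℝ} (hA : 0 ≤ A) :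
    |walkE (cellStep n p) p (N + 1) 0
        (fun s => A * φ 0 (normSq s) + 2 * normSq s * φ 1 (normSq s))
      - walkE (cellStep n p) p N 0
        (fun s => A * φ 0 (normSq s) + 2 * normSq s * φ 1 (normSq s))|
      ≤ 1 / n * (m * (A + 2) * C 1 + (16 * m ^ 2 + 16 * m * (A + 4)) * C 2
        + 280 * m ^ 2 * C 3) := by
  have hp := pos_of_one_le_mul hnp
  set g : (Fin m → ℝ) → ℝ :=
    fun s => A * φ 0 (normSq s) + 2 * normSq s * φ 1 (normSq s) with hg
  have n2 := bound_nonneg hC (k := 2) (by norm_num) (by norm_num)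
  have n3 := bound_nonneg hC (k := 3) (by norm_num) (by norm_num)
  have hn' : (0 : ℝ) < n := by exact_mod_cast hn
  have hpt : ∀ s, OnHyperplane p s → |shiftOp (cellStep n p) p 1 g s - g s|
      ≤ 1 / n * (m * (A + 2) * C 1 + (2 * m * C 2 + 2 * (A + 4) * C 2) * (∑ j, (1 + |s j|) ^ 2)
        + 4 * C 3 * m * ∑ j, (1 + |s j|) ^ 4) := by
    intro s hs
    set L : Fin m → ℝ := fun k => (cellScale n p k * s k)
      * (2 * ((A + 2) * φ 1 (normSq s) + 2 * normSq s * φ 2 (normSq s))) with hL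
    have hL0 : ∑ k, p k * L k = 0 := by
      simp only [hL, ← mul_assoc]
      simp only [mul_assoc (p _) (cellScale n p _), ← Finset.sum_mul,
        sum_mul_cellScale_mul hp1 hs, zero_mul]
    have e : shiftOp (cellStep n p) p 1 g s - g s
        = ∑ k, p k * (g (s + (1 : ℝ) • cellStep n p k) - g s - L k) := by
      simp only [mul_sub, Finset.sum_sub_distrib, hL0, sub_zero, ← Finset.sum_mul, hp1, one_mul]
      rfl
    set Y := ∑ j, (1 + |s j|) ^ 2 with hY
    -- Cauchy–Schwarz avoids joint moments of two coordinates.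
    have hYY : Y * Y ≤ m * ∑ j, (1 + |s j|) ^ 4 := by
      have := sq_sum_le_card_mul_sum_sq (s := Finset.univ) (f := fun j => (1 + |s j|) ^ 2)
      simp only [Finset.card_univ, Fintype.card_fin, ← pow_mul] at this
      rw [← sq]; exact this
    rw [e]
    calc _ ≤ ∑ k, p k * (cellScale n p k ^ 2 * ((A + 2) * C 1 + 2 * Y * C 2
          + 2 * (1 + |s k|) ^ 2 * (A + 4) * C 2 + 4 * (1 + |s k|) ^ 2 * Y * C 3)) := by
          refine (Finset.abs_sum_le_sum_abs _ _).trans (Finset.sum_le_sum fun k _ => ?_)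
          rw [abs_mul, abs_of_pos (hp k)]
          refine mul_le_mul_of_nonneg_left ?_ (hp k).le
          have key := abs_taylor_laguerre_le (w := normSq s) (α := cellScale n p k * s k)
            (β := normSq (cellStep n p k)) (c := cellScale n p k) (y := 1 + |s k|) (A := A)
            (Y := Y) hφ hC (increment_nonneg hs k)
            (normSq_nonneg _) (normSq_cellStep_le hnp k hp1) hA
            (fun t ht => abs_increment_inner_le hnp hp1 k ht)
            (fun t ht => increment_le hn hnp hp1 hs k ht)
          refine le_of_eq_of_le ?_ key
          simp only [hg, normSq_add_smul hs, hL]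
          congr 1; norm_num
      _ = ∑ k, 1 / n * ((A + 2) * C 1 + 2 * Y * C 2
          + 2 * (1 + |s k|) ^ 2 * (A + 4) * C 2 + 4 * (1 + |s k|) ^ 2 * Y * C 3) := by
          refine Finset.sum_congr rfl fun k _ => ?_
          have := mul_cellScale_sq hnp k
          rw [← mul_assoc, eq_div_of_mul_eq hn'.ne' (by rw [← this]; ring :
            p k * cellScale n p k ^ 2 * n = 1)]
      _ = 1 / n * (m * (A + 2) * C 1 + (2 * m * C 2 + 2 * (A + 4) * C 2) * Y
          + 4 * C 3 * (Y * Y)) := by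
          have e1 : ∀ k, (A + 2) * C 1 + 2 * Y * C 2
              + 2 * (1 + |s k|) ^ 2 * (A + 4) * C 2 + 4 * (1 + |s k|) ^ 2 * Y * C 3
              = ((A + 2) * C 1 + 2 * Y * C 2)
                + (1 + |s k|) ^ 2 * (2 * (A + 4) * C 2 + 4 * Y * C 3) := fun k => by ring
          rw [← Finset.mul_sum, Finset.sum_congr rfl fun k _ => e1 k, Finset.sum_add_distrib,
            ← Finset.sum_mul, ← hY]
          simp only [Finset.sum_const, Finset.card_univ, Fintype.card_fin, nsmul_eq_mul]
          ring
      _ ≤ 1 / n * (m * (A + 2) * C 1 + (2 * m * C 2 + 2 * (A + 4) * C 2) * Y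
          + 4 * C 3 * (m * ∑ j, (1 + |s j|) ^ 4)) := by gcongr
      _ = _ := by ring
  rw [walkE_succ, ← walkE_sub]
  refine (abs_walk_le hnp hp1 hpt).trans ?_
  have hab : N + 0 ≤ n := by omega
  have a2 : ∑ j, walkE (cellStep n p) p N 0 (fun s => (1 + |s j|) ^ 2) ≤ m * 8 := by
    have := Finset.sum_le_sum fun j (_ : j ∈ Finset.univ) => walk_moment_two_le hn hnp hp1 hab j
    simpa using this
  have a4 : ∑ j, walkE (cellStep n p) p N 0 (fun s => (1 + |s j|) ^ 4) ≤ m * 70 := by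
    have := Finset.sum_le_sum fun j (_ : j ∈ Finset.univ) => walk_moment_four_le hn hnp hp1 hab j
    simpa using this
  rw [walkE_const_mul, walkE_add, walkE_add, walkE_const hp1, walkE_const_mul, walkE_const_mul,
    walkE_sum, walkE_sum]
  calc _ ≤ 1 / n * (m * (A + 2) * C 1 + (2 * m * C 2 + 2 * (A + 4) * C 2) * (m * 8)
        + 4 * C 3 * m * (m * 70)) := by gcongr
    _ = _ := by ring

/-- The expansion of `E |S|² φ(|S|²)` for the standardized counts `S`. -/
theorem abs_walk_normSq_mul_sub_le {N : ℕ} (hN : n = N + 1) :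
    |walkE (cellStep n p) p (N + 1) 0 (fun s => normSq s * φ 0 (normSq s))
      - walkE (cellStep n p) p N 0
        (fun s => ((m : ℝ) - 1) * φ 0 (normSq s) + 2 * normSq s * φ 1 (normSq s))
      - ∑ k, cellScale n p k * walkE (cellStep n p) p N 0
        (fun s => 3 * s k * φ 1 (normSq s) + 2 * s k ^ 3 * φ 2 (normSq s))|
      ≤ (∑ k, cellScale n p k ^ 2) * (C 1 + 32 * C 2 + 280 / 3 * C 3) := by
  have hp := pos_of_one_le_mul hnp
  have n2 := bound_nonneg hC (k := 2) (by norm_num) (by norm_num)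
  have n3 := bound_nonneg hC (k := 3) (by norm_num) (by norm_num)
  have hn' : (0 : ℝ) < n := by exact_mod_cast hn
  have hnN : (N : ℝ) + 1 = n := by rw [hN]; push_cast; ring
  set β : Fin m → ℝ := fun k => normSq (cellStep n p k) with hβ
  -- Exchangeability is applied to each factor `s j` of `∑ s_j (s_j φ)`; summing over `j`
  -- reassembles the inner product of the last step with the endpoint, which is `c_k s_k + β_k`.
  have e1 : walkE (cellStep n p) p (N + 1) 0 (fun s => normSq s * φ 0 (normSq s))
      = walkE (cellStep n p) p N 0 (fun s => ∑ k, n * p k * ((cellScale n p k * s k + β k)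
        * φ 0 (normSq s + 2 * (cellScale n p k * s k) + β k))) := by
    have e : (fun s : Fin m → ℝ => normSq s * φ 0 (normSq s))
        = fun s => ∑ j, s j * (s j * φ 0 (normSq s)) := by
      funext s
      rw [normSq, Finset.sum_mul]
      exact Finset.sum_congr rfl fun j _ => by ring
    rw [e, walkE_sum]
    simp only [walkE_coord_mul, hnN]
    rw [← Finset.mul_sum, ← walkE_sum, ← walkE_const_mul]
    refine walk_congr hnp hp1 fun s hs => ?_
    simp only [shiftOp_apply]
    rw [Finset.sum_comm, Finset.mul_sum]
    refine Finset.sum_congr rfl fun k _ => ?_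
    have h1 := cellStep_inner (n := n) (OnHyperplane.add_smul_cellStep (n := n) hp hp1 s k 1 hs) k
    have h2 : ∑ j, cellStep n p k j * (s + (1 : ℝ) • cellStep n p k) j
        = cellScale n p k * s k + β k := by
      simp only [Pi.add_apply, Pi.smul_apply, smul_eq_mul, mul_add, one_mul,
        Finset.sum_add_distrib, cellStep_inner hs, hβ, normSq, sq]
    have h3 : ∀ j, p k * cellStep n p k j * ((s + (1 : ℝ) • cellStep n p k) j
          * φ 0 (normSq (s + (1 : ℝ) • cellStep n p k)))
        = cellStep n p k j * (s + (1 : ℝ) • cellStep n p k) j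
          * (p k * φ 0 (normSq (s + (1 : ℝ) • cellStep n p k))) := fun j => by ring
    rw [Finset.sum_congr rfl fun j _ => h3 j, ← Finset.sum_mul, h2, normSq_add_smul hs]
    simp only [hβ]
    ring_nf
  have e2 : ∑ k, cellScale n p k * walkE (cellStep n p) p N 0
        (fun s => 3 * s k * φ 1 (normSq s) + 2 * s k ^ 3 * φ 2 (normSq s))
      = walkE (cellStep n p) p N 0 (fun s => ∑ k, cellScale n p k
        * (3 * s k * φ 1 (normSq s) + 2 * s k ^ 3 * φ 2 (normSq s))) := by
    rw [walkE_sum]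
    simp only [walkE_const_mul]
  have hpt : ∀ s, OnHyperplane p s →
      |∑ k, n * p k * ((cellScale n p k * s k + β k)
        * φ 0 (normSq s + 2 * (cellScale n p k * s k) + β k))
      - (((m : ℝ) - 1) * φ 0 (normSq s) + 2 * normSq s * φ 1 (normSq s))
      - ∑ k, cellScale n p k * (3 * s k * φ 1 (normSq s) + 2 * s k ^ 3 * φ 2 (normSq s))|
      ≤ ∑ k, cellScale n p k ^ 2
        * (C 1 + 4 * C 2 * (1 + |s k|) ^ 2 + 4 / 3 * C 3 * (1 + |s k|) ^ 4) := by
    intro s hs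
    have hβk : ∀ k, β k = cellScale n p k ^ 2 - 1 / n := fun k => normSq_cellStep hnp hp1 k
    have b0 : ∑ k, n * p k * (cellScale n p k * s k) = 0 := by
      simp only [mul_assoc (n : ℝ), ← Finset.mul_sum, sum_mul_cellScale_mul hp1 hs, mul_zero]
    -- Each term equals `1 - p k`: this is where the degrees of freedom arise.
    have b1 : ∑ k, n * p k * β k = m - 1 := by
      simp only [hβk, mul_sub, mul_cellScale_sq hnp, Finset.sum_sub_distrib]
      simp only [mul_one_div, mul_div_assoc, Finset.sum_const, Finset.card_univ, Fintype.card_fin,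
        nsmul_eq_mul, mul_one, ← Finset.mul_sum, ← Finset.sum_div, hp1]
      field_simp
    have b2 : ∑ k, n * p k * (2 * (cellScale n p k * s k) ^ 2) = 2 * normSq s := by
      rw [normSq, Finset.mul_sum]
      refine Finset.sum_congr rfl fun k _ => ?_
      calc _ = n * p k * cellScale n p k ^ 2 * (2 * s k ^ 2) := by ring
        _ = _ := by rw [mul_cellScale_sq hnp, one_mul]
    have b3 : ∑ k, n * p k * (3 * β k * (cellScale n p k * s k))
        = ∑ k, cellScale n p k * (3 * s k) := by
      -- The part `-1 / n` of `β k` contributes a multiple of the vanishing sum `b0`.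
      have : ∀ k, n * p k * (3 * β k * (cellScale n p k * s k))
          = cellScale n p k * (3 * s k) - 3 / n * (n * p k * (cellScale n p k * s k)) := by
        intro k
        rw [hβk]
        calc _ = n * p k * cellScale n p k ^ 2 * (cellScale n p k * (3 * s k))
              - 3 / n * (n * p k * (cellScale n p k * s k)) := by ring
          _ = _ := by rw [mul_cellScale_sq hnp, one_mul]
      rw [Finset.sum_congr rfl fun k _ => this k, Finset.sum_sub_distrib, ← Finset.mul_sum, b0,
        mul_zero, sub_zero]
    have b4 : ∀ k, n * p k * (2 * (cellScale n p k * s k) ^ 3)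
        = cellScale n p k * (2 * s k ^ 3) := by
      intro k
      calc _ = n * p k * cellScale n p k ^ 2 * (cellScale n p k * (2 * s k ^ 3)) := by ring
        _ = _ := by rw [mul_cellScale_sq hnp, one_mul]
    have e : ∑ k, n * p k * ((cellScale n p k * s k + β k)
        * φ 0 (normSq s + 2 * (cellScale n p k * s k) + β k))
      - (((m : ℝ) - 1) * φ 0 (normSq s) + 2 * normSq s * φ 1 (normSq s))
      - ∑ k, cellScale n p k * (3 * s k * φ 1 (normSq s) + 2 * s k ^ 3 * φ 2 (normSq s))
      = ∑ k, n * p k * ((cellScale n p k * s k + β k)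
        * φ 0 (normSq s + 2 * (cellScale n p k * s k) + β k)
        - cellScale n p k * s k * φ 0 (normSq s)
        - (β k * φ 0 (normSq s) + 2 * (cellScale n p k * s k) ^ 2 * φ 1 (normSq s))
        - (6 * β k * (cellScale n p k * s k) * φ 1 (normSq s)
          + 4 * (cellScale n p k * s k) ^ 3 * φ 2 (normSq s)) / 2) := by
      have c1 : ∑ k, cellScale n p k * (3 * s k * φ 1 (normSq s) + 2 * s k ^ 3 * φ 2 (normSq s))
          = (∑ k, n * p k * (3 * β k * (cellScale n p k * s k))) * φ 1 (normSq s)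
            + (∑ k, n * p k * (2 * (cellScale n p k * s k) ^ 3)) * φ 2 (normSq s) := by
        rw [b3, Finset.sum_congr rfl fun k _ => b4 k, Finset.sum_mul, Finset.sum_mul,
          ← Finset.sum_add_distrib]
        exact Finset.sum_congr rfl fun k _ => by ring
      have c0 : ∑ k, n * p k * (cellScale n p k * s k) * φ 0 (normSq s) = 0 := by
        rw [← Finset.sum_mul, b0, zero_mul]
      rw [c1, ← b1, ← b2, ← sub_zero (∑ k, n * p k * ((cellScale n p k * s k + β k)
        * φ 0 (normSq s + 2 * (cellScale n p k * s k) + β k))), ← c0]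
      simp only [Finset.sum_mul, ← Finset.sum_add_distrib, ← Finset.sum_sub_distrib]
      exact Finset.sum_congr rfl fun k _ => by ring
    rw [e]
    refine (Finset.abs_sum_le_sum_abs _ _).trans (Finset.sum_le_sum fun k _ => ?_)
    have hk := hp k
    have key := abs_taylor_mul_phi_le (w := normSq s) (α := cellScale n p k * s k)
      (β := β k) (c := cellScale n p k) (y := 1 + |s k|) hφ hC (increment_nonneg hs k)
      (normSq_nonneg _) (normSq_cellStep_le hnp k hp1)
      (fun t ht => abs_increment_inner_le hnp hp1 k ht)
    rw [abs_mul, abs_of_pos (by positivity : (0 : ℝ) < n * p k)]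
    calc _ ≤ n * p k * (cellScale n p k ^ 4 * (C 1 + 4 * (1 + |s k|) ^ 2 * C 2
          + 4 / 3 * (1 + |s k|) ^ 4 * C 3)) := by gcongr
      _ = n * p k * cellScale n p k ^ 2 * (cellScale n p k ^ 2 * (C 1 + 4 * (1 + |s k|) ^ 2 * C 2
          + 4 / 3 * (1 + |s k|) ^ 4 * C 3)) := by ring
      _ = _ := by rw [mul_cellScale_sq hnp]; ring
  rw [e1, e2, ← walkE_sub, ← walkE_sub]
  refine (abs_walk_le hnp hp1 hpt).trans ?_
  rw [walkE_sum, Finset.sum_mul]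
  refine Finset.sum_le_sum fun k _ => ?_
  have hab : N + 0 ≤ n := by omega
  rw [walkE_const_mul, walkE_add, walkE_add, walkE_const hp1, walkE_const_mul, walkE_const_mul]
  have a2 := walk_moment_two_le hn hnp hp1 hab k
  have a4 := walk_moment_four_le hn hnp hp1 hab k
  refine mul_le_mul_of_nonneg_left ?_ (sq_nonneg _)
  calc _ ≤ C 1 + 4 * C 2 * 8 + 4 / 3 * C 3 * 70 := by gcongr
    _ = _ := by ring

/-- The bound for the expectation of the Stein operator at Pearson's statistic. -/
theorem abs_walk_stein_le (hm : 2 ≤ m) :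
    |walkE (cellStep n p) p n 0 (fun s => normSq s * φ 1 (normSq s)
        + (((m : ℝ) - 1) - normSq s) / 2 * φ 0 (normSq s))|
      ≤ (∑ k, cellScale n p k) ^ 2
        * (2 * C 1 + 47 * C 2 + 307 * C 3 + 700 * C 4 + 2400 * C 5) := by
  obtain ⟨N, hN⟩ : ∃ N, n = N + 1 := ⟨n - 1, by omega⟩
  have n1 := bound_nonneg hC (k := 1) (by norm_num) (by norm_num)
  have n2 := bound_nonneg hC (k := 2) (by norm_num) (by norm_num)
  have n3 := bound_nonneg hC (k := 3) (by norm_num) (by norm_num)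
  have n4 := bound_nonneg hC (k := 4) (by norm_num) (by norm_num)
  have n5 := bound_nonneg hC (k := 5) (by norm_num) (by norm_num)
  have hm' : (2 : ℝ) ≤ m := by exact_mod_cast hm
  have hn' : (0 : ℝ) < n := by exact_mod_cast hn
  have b1 := abs_walk_normSq_mul_sub_le hn hnp hp1 hφ hC hN
  have b2 := abs_walk_succ_sub_le hn hnp hp1 hφ hC (N := N) (by omega) (A := (m : ℝ) - 1)
    (by linarith)
  have b3 : |∑ k, cellScale n p k * walkE (cellStep n p) p N 0
        (fun s => 3 * s k * φ 1 (normSq s) + 2 * s k ^ 3 * φ 2 (normSq s))|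
      ≤ (∑ k, cellScale n p k) * ((∑ k, cellScale n p k) / 6
        * (30 * C 2 + 1440 * C 3 + 8400 * C 4 + 28800 * C 5)) := by
    refine (Finset.abs_sum_le_sum_abs _ _).trans ?_
    rw [Finset.sum_mul]
    refine Finset.sum_le_sum fun k _ => ?_
    have hc := cellScale_pos hnp k
    rw [abs_mul, abs_of_pos hc]
    gcongr
    exact abs_walk_odd_le hn hnp hp1 hφ hC (by omega) k
  have hQ := sq_le_mul_sum_cellScale_sq hn hnp hp1
  have hQ2 : ∑ k, cellScale n p k ^ 2 ≤ (∑ k, cellScale n p k) ^ 2 :=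
    Finset.sum_sq_le_sq_sum_of_nonneg fun k _ => (cellScale_pos hnp k).le
  have e : walkE (cellStep n p) p n 0 (fun s => normSq s * φ 1 (normSq s)
        + (((m : ℝ) - 1) - normSq s) / 2 * φ 0 (normSq s))
      = 1 / 2 * (walkE (cellStep n p) p (N + 1) 0
          (fun s => ((m : ℝ) - 1) * φ 0 (normSq s) + 2 * normSq s * φ 1 (normSq s))
        - walkE (cellStep n p) p (N + 1) 0 (fun s => normSq s * φ 0 (normSq s))) := by
    rw [← walkE_sub, ← walkE_const_mul, ← hN]
    congr 1
    funext s
    ring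
  set S := ∑ k, cellScale n p k
  have d1 : (∑ k, cellScale n p k ^ 2) * (C 1 + 32 * C 2 + 280 / 3 * C 3)
      ≤ S ^ 2 * (C 1 + 32 * C 2 + 280 / 3 * C 3) := by gcongr
  -- The constants `3 / 2` and `56` are attained at `m = 2`, the worst case.
  have d2 : 1 / n * (m * ((m : ℝ) - 1 + 2) * C 1 + (16 * m ^ 2 + 16 * m * ((m : ℝ) - 1 + 4)) * C 2
        + 280 * m ^ 2 * C 3) ≤ S ^ 2 * (3 / 2 * C 1 + 56 * C 2 + 280 * C 3) := by
    calc _ ≤ 1 / (n : ℝ) * (3 / 2 * m ^ 2 * C 1 + 56 * m ^ 2 * C 2 + 280 * m ^ 2 * C 3) := by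
          refine mul_le_mul_of_nonneg_left ?_ (by positivity)
          have h1 : (m : ℝ) * ((m : ℝ) - 1 + 2) ≤ 3 / 2 * m ^ 2 := by nlinarith
          have h2 : 16 * (m : ℝ) ^ 2 + 16 * m * ((m : ℝ) - 1 + 4) ≤ 56 * m ^ 2 := by nlinarith
          have h3 := mul_le_mul_of_nonneg_right h1 n1
          have h4 := mul_le_mul_of_nonneg_right h2 n2
          linarith
      _ = m ^ 2 / n * (3 / 2 * C 1 + 56 * C 2 + 280 * C 3) := by ring
      _ ≤ _ := by gcongr
  rw [e, abs_mul, abs_of_pos (by norm_num : (0 : ℝ) < 1 / 2)]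
  have b1' := abs_le.1 b1
  have b2' := abs_le.1 b2
  have b3' := abs_le.1 b3
  have hS2 : 0 ≤ S ^ 2 := sq_nonneg _
  have p1 := mul_nonneg hS2 n1
  have p2 := mul_nonneg hS2 n2
  have p3 := mul_nonneg hS2 n3
  have hfin : |walkE (cellStep n p) p (N + 1) 0
          (fun s => ((m : ℝ) - 1) * φ 0 (normSq s) + 2 * normSq s * φ 1 (normSq s))
        - walkE (cellStep n p) p (N + 1) 0 (fun s => normSq s * φ 0 (normSq s))|
      ≤ S ^ 2 * (3 / 2 * C 1 + 56 * C 2 + 280 * C 3)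
        + S * (S / 6 * (30 * C 2 + 1440 * C 3 + 8400 * C 4 + 28800 * C 5))
        + S ^ 2 * (C 1 + 32 * C 2 + 280 / 3 * C 3) := by
    rw [abs_le]
    constructor <;> linarith
  linarith

end SteinExpectation

/-! ### From the multinomial law to the walk -/

section Law

variable {m : ℕ} {p : Fin m → ℝ}

theorem trialLaw_singleton (p : Fin m → ℝ) (j : Fin m) : trialLaw p {j} = ENNReal.ofReal (p j) := by
  rw [trialLaw, Measure.finsetSum_apply]
  simp only [Measure.smul_apply, smul_eq_mul, Measure.dirac_apply' _ (measurableSet_singleton j)]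
  rw [Finset.sum_eq_single j]
  · simp
  · intro k _ hk
    simp [hk]
  · simp

theorem isProbabilityMeasure_trialLaw (hp : ∀ k, 0 ≤ p k) (hp1 : ∑ k, p k = 1) :
    IsProbabilityMeasure (trialLaw p) where
  measure_univ := by
    rw [trialLaw, Measure.finsetSum_apply]
    simp only [Measure.smul_apply, smul_eq_mul, measure_univ, mul_one]
    rw [← ENNReal.ofReal_sum_of_nonneg fun k _ => hp k, hp1, ENNReal.ofReal_one]

theorem integral_pi_trialLaw (hp : ∀ k, 0 ≤ p k) (hp1 : ∑ k, p k = 1) (N : ℕ)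
    (f : (Fin N → Fin m) → ℝ) :
    ∫ x, f x ∂(Measure.pi fun _ : Fin N => trialLaw p) = ∑ x, (∏ i, p (x i)) * f x := by
  have := isProbabilityMeasure_trialLaw hp hp1
  rw [integral_fintype Integrable.of_finite]
  refine Finset.sum_congr rfl fun x _ => ?_
  rw [smul_eq_mul, measureReal_def, Measure.pi_singleton]
  simp only [trialLaw_singleton]
  rw [ENNReal.toReal_prod]
  simp only [ENNReal.toReal_ofReal (hp _)]

/-- Conditioning on the first trial corresponds to peeling off one shift operator; the general
starting point `s` makes the induction close. -/
theorem sum_prod_mul_eq_shiftOp_pow {J : Type*} (ξ : Fin m → J → ℝ) (p : Fin m → ℝ)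
    (F : (J → ℝ) → ℝ) (N : ℕ) (s : J → ℝ) :
    ∑ x : Fin N → Fin m, (∏ i, p (x i)) * F (s + ∑ i, ξ (x i)) = (shiftOp ξ p 1 ^ N) F s := by
  induction N generalizing s with
  | zero => simp
  | succ N ih =>
    rw [pow_succ', Module.End.mul_apply, shiftOp_apply,
      ← (Fin.consEquiv fun _ : Fin (N + 1) => Fin m).sum_comp, Fintype.sum_prod_type]
    refine Finset.sum_congr rfl fun k _ => ?_
    rw [← ih, Finset.mul_sum]
    refine Finset.sum_congr rfl fun x _ => ?_
    simp only [Fin.consEquiv_apply, Fin.prod_univ_succ, Fin.sum_univ_succ, Fin.cons_zero,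
      Fin.cons_succ, one_smul, mul_assoc, add_assoc]

theorem pearsonStat_counts {n : ℕ} (p : Fin m → ℝ) (hp : ∀ k, 0 < p k)
    (x : Fin n → Fin m) : pearsonStat n p (counts x) = normSq (∑ i, cellStep n p (x i)) := by
  refine Finset.sum_congr rfl fun j _ => ?_
  have hj := Real.sqrt_pos.2 (hp j)
  have e : (∑ i, cellStep n p (x i)) j = ((counts x j : ℝ) - n * p j) / √(n * p j) := by
    rw [Finset.sum_apply]
    simp only [cellStep]
    rw [← Finset.sum_div, Finset.sum_sub_distrib, ← Finset.sum_filter, Finset.sum_const,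
      Finset.sum_const, Finset.card_univ, Fintype.card_fin, nsmul_eq_mul, nsmul_eq_mul,
      Real.sqrt_mul (Nat.cast_nonneg n), mul_comm √(n : ℝ), ← div_div]
    congr 1
    have h1 : p j = √(p j) * √(p j) := (Real.mul_self_sqrt (hp j).le).symm
    rw [sub_div, mul_div_assoc (n : ℝ), Real.div_sqrt, mul_one_div]
    rfl
  rw [e, div_pow, Real.sq_sqrt (mul_nonneg (Nat.cast_nonneg n) (hp j).le)]

theorem integral_pearsonStat {Ω : Type*} [MeasurableSpace Ω] {P : Measure Ω} {n : ℕ}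
    (hp : ∀ k, 0 < p k) (hp1 : ∑ k, p k = 1) {U : Ω → Fin m → ℕ}
    (hU : HasLaw U (multinomialLaw n p) P) (f : ℝ → ℝ) :
    ∫ ω, f (pearsonStat n p (U ω)) ∂P
      = walkE (cellStep n p) p n 0 (fun s => f (normSq s)) := by
  have hm : Measurable fun u : Fin m → ℕ => f (pearsonStat n p u) := Measurable.of_discrete
  have h1 := hU.integral_comp (f := fun u => f (pearsonStat n p u)) hm.aestronglyMeasurable
  refine h1.trans ?_
  rw [multinomialLaw, integral_map Measurable.of_discrete.aemeasurable hm.aestronglyMeasurable,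
    integral_pi_trialLaw (fun k => (hp k).le) hp1]
  simp only [pearsonStat_counts p hp]
  have := sum_prod_mul_eq_shiftOp_pow (cellStep n p) p (fun s => f (normSq s)) n 0
  simp only [zero_add] at this
  rw [this]
  rfl

end Law

/-! ### Passage to the boundary point zero and conclusion -/

section Limit

variable {ι J X : Type*} [Fintype ι] {ξ : ι → J → ℝ} {p : ι → ℝ}

open Filter Topology in
theorem tendsto_shiftOp_pow {l : Filter X} {F : X → (J → ℝ) → ℝ} {G : (J → ℝ) → ℝ}
    (hF : ∀ s, Tendsto (fun e => F e s) l (𝓝 (G s))) (ε : ℝ) (N : ℕ) (s : J → ℝ) :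
    Tendsto (fun e => (shiftOp ξ p ε ^ N) (F e) s) l (𝓝 ((shiftOp ξ p ε ^ N) G s)) := by
  induction N generalizing s with
  | zero => exact hF s
  | succ N ih =>
    simp only [pow_succ', Module.End.mul_apply, shiftOp_apply]
    exact tendsto_finsetSum _ fun k _ => (ih _).const_mul _

open Filter Topology in
theorem tendsto_walkE {l : Filter X} {F : X → (J → ℝ) → ℝ} {G : (J → ℝ) → ℝ}
    (hF : ∀ s, Tendsto (fun e => F e s) l (𝓝 (G s))) (a b : ℕ) :
    Tendsto (fun e => walkE ξ p a b (F e)) l (𝓝 (walkE ξ p a b G)) :=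
  tendsto_shiftOp_pow (tendsto_shiftOp_pow hF (-1) b) 1 a 0

end Limit

open Filter Topology in
-- The statistic may be `0`, where the Stein solution need not be smooth. The solution is therefore
-- evaluated at `normSq s + ε`, which changes the Stein operator by at most `ε (C 1 + B / 2)`;
-- continuity of `h` on `[0, ∞)` permits `ε → 0`.
theorem abs_walk_sub_integral_le {m n : ℕ} {p : Fin m → ℝ} {h : ℝ → ℝ} (hm : 2 ≤ m) (hn : 0 < n)
    (hnp : ∀ j, 1 ≤ (n : ℝ) * p j) (hp1 : ∑ k, p k = 1) (hh : MemCb 5 h) {H : ℕ → ℝ}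
    (hH : ∀ k, H k = supNorm (iteratedDeriv k h)) :
    |walkE (cellStep n p) p n 0 (fun s => h (normSq s))
        - ∫ x, h x ∂(chiSquareMeasure (m - 1))|
      ≤ (∑ k, cellScale n p k) ^ 2 * (4 / ((m : ℝ) + 1)
        * (12 * H 0 + 98 * H 1 + 708 * H 2 + 2014 * H 3 + 6200 * H 4 + 4800 * H 5)) := by
  obtain ⟨φ, hφ, hstein, ⟨B, hB⟩, h1, hk⟩ := hh.exists_stein_solution (d := m - 1) (by omega)
  set c := ∫ x, h x ∂(chiSquareMeasure (m - 1)) with hc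
  have hcast : ((m - 1 : ℕ) : ℝ) = (m : ℝ) - 1 := by
    rw [Nat.cast_sub (by omega), Nat.cast_one]
  have e2 : ((m - 1 : ℕ) : ℝ) + 2 = m + 1 := by rw [hcast]; ring
  rw [e2] at h1
  simp only [e2] at hk
  simp only [hcast] at hstein
  set a := 4 / ((m : ℝ) + 1) with ha
  set C : ℕ → ℝ := fun k => if k = 1 then a * (6 * supNorm h + 2 * H 1)
    else a * (2 * H (k - 1) + 2 * H k) with hCdef
  have hCb : ∀ k, 1 ≤ k → k ≤ 5 → ∀ x, 0 < x → |φ k x| ≤ C k := by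
    intro k hk1 hk5 x hx
    rcases eq_or_lt_of_le hk1 with rfl | hlt
    · simp only [hCdef, if_true, hH]
      exact h1 x hx
    · obtain ⟨l, rfl⟩ : ∃ l, k = l + 1 := ⟨k - 1, by omega⟩
      have hl : l + 1 ≠ 1 := by omega
      simp only [hCdef, if_neg hl, hH, Nat.add_sub_cancel]
      exact hk l (by omega) (by omega) x hx
  set K := (∑ k, cellScale n p k) ^ 2
    * (2 * C 1 + 47 * C 2 + 307 * C 3 + 700 * C 4 + 2400 * C 5) with hK
  have hε : ∀ ε : ℝ, 0 < ε → |walkE (cellStep n p) p n 0 (fun s => h (normSq s + ε)) - c|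
      ≤ K + ε * (C 1 + B / 2) := by
    intro ε hε
    have key := abs_walk_stein_le (φ := fun k x => φ k (x + ε)) (C := C) hn hnp hp1
      (fun k hk x hx => (hφ k (by omega) (x + ε) (by linarith)).comp_add_const x ε)
      (fun k hk1 hk5 x hx => hCb k hk1 hk5 (x + ε) (by linarith)) hm
    have e : walkE (cellStep n p) p n 0 (fun s => normSq s * φ 1 (normSq s + ε)
        + (((m : ℝ) - 1) - normSq s) / 2 * φ 0 (normSq s + ε))
        = walkE (cellStep n p) p n 0 (fun s => h (normSq s + ε)) - c
          - walkE (cellStep n p) p n 0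
            (fun s => ε * (φ 1 (normSq s + ε) - 1 / 2 * φ 0 (normSq s + ε))) := by
      rw [← walkE_const (ξ := cellStep n p) hp1 n 0 c, ← walkE_sub, ← walkE_sub]
      congr 1
      funext s
      have := hstein (normSq s + ε) (by linarith [normSq_nonneg s])
      rw [← this]; ring
    rw [e] at key
    have hr : |walkE (cellStep n p) p n 0
        (fun s => ε * (φ 1 (normSq s + ε) - 1 / 2 * φ 0 (normSq s + ε)))| ≤ ε * (C 1 + B / 2) := by
      refine (abs_walk_le hnp hp1 (G := fun _ => ε * (C 1 + B / 2)) fun s _ => ?_).trans_eq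
        (walkE_const hp1 _ _ _)
      have hpos : 0 < normSq s + ε := by linarith [normSq_nonneg s]
      rw [abs_mul, abs_of_pos hε]
      have q1 := hCb 1 le_rfl (by norm_num) _ hpos
      have q0 := hB _ hpos
      have q2 := abs_sub (φ 1 (normSq s + ε)) (1 / 2 * φ 0 (normSq s + ε))
      rw [abs_mul, abs_of_pos (by norm_num : (0 : ℝ) < 1 / 2)] at q2
      gcongr
      linarith
    have k1 := abs_le.1 key
    have k2 := abs_le.1 hr
    rw [abs_le]
    constructor <;> linarith
  have hlim : Tendsto (fun ε : ℝ => walkE (cellStep n p) p n 0 (fun s => h (normSq s + ε)))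
      (𝓝[>] 0) (𝓝 (walkE (cellStep n p) p n 0 (fun s => h (normSq s)))) := by
    refine tendsto_walkE (fun s => ?_) n 0
    have h0 := normSq_nonneg s
    refine (hh.continuousOn (normSq s) h0).tendsto.comp (tendsto_nhdsWithin_iff.2 ⟨?_, ?_⟩)
    · have : Tendsto (fun ε : ℝ => normSq s + ε) (𝓝 0) (𝓝 (normSq s + 0)) :=
        tendsto_const_nhds.add tendsto_id
      rw [add_zero] at this
      exact this.mono_left nhdsWithin_le_nhds
    · filter_upwards [self_mem_nhdsWithin] with ε hε
      exact add_nonneg h0 (le_of_lt hε)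
  have hlim2 : Tendsto (fun ε : ℝ => K + ε * (C 1 + B / 2)) (𝓝[>] 0) (𝓝 K) := by
    have : Tendsto (fun ε : ℝ => K + ε * (C 1 + B / 2)) (𝓝 0) (𝓝 (K + 0 * (C 1 + B / 2))) :=
      tendsto_const_nhds.add (tendsto_id.mul_const _)
    rw [zero_mul, add_zero] at this
    exact this.mono_left nhdsWithin_le_nhds
  have hfin := le_of_tendsto_of_tendsto (hlim.sub_const c).abs hlim2
    (by filter_upwards [self_mem_nhdsWithin] with ε h using hε ε h)
  refine hfin.trans_eq ?_
  have h0 : supNorm h = H 0 := by rw [hH, iteratedDeriv_zero]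
  have c1 : C 1 = a * (6 * H 0 + 2 * H 1) := by simp only [hCdef, if_true, h0]
  have c2 : C 2 = a * (2 * H 1 + 2 * H 2) := rfl
  have c3 : C 3 = a * (2 * H 2 + 2 * H 3) := rfl
  have c4 : C 4 = a * (2 * H 3 + 2 * H 4) := rfl
  have c5 : C 5 = a * (2 * H 4 + 2 * H 5) := rfl
  rw [hK, c1, c2, c3, c4, c5]
  ring

end PearsonChiSq

end

theorem theorem4p2 {Ω : Type*} [MeasurableSpace Ω] (P : Measure Ω) [IsProbabilityMeasure P]
    (n m : ℕ) (hn : 2 ≤ n) (hm : 2 ≤ m)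
    (p : Fin m → ℝ) (hp_sum : ∑ j, p j = 1) (hnp : ∀ j, 1 ≤ (n : ℝ) * p j)
    (U : Ω → Fin m → ℕ) (hU : HasLaw U (PearsonChiSq.multinomialLaw n p) P)
    (h : ℝ → ℝ) (hh : PearsonChiSq.MemCb 5 h) :
    |(∫ ω, h (PearsonChiSq.pearsonStat n p (U ω)) ∂P)
        - ∫ x, h x ∂(PearsonChiSq.chiSquareMeasure (m - 1))| ≤
      4 / (((m : ℝ) + 1) * n) * (∑ j, 1 / √(p j)) ^ 2 *
        (19 * PearsonChiSq.supNorm h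
          + 366 * PearsonChiSq.supNorm (iteratedDeriv 1 h)
          + 2016 * PearsonChiSq.supNorm (iteratedDeriv 2 h)
          + 5264 * PearsonChiSq.supNorm (iteratedDeriv 3 h)
          + 106965 * PearsonChiSq.supNorm (iteratedDeriv 4 h)
          + 302922 * PearsonChiSq.supNorm (iteratedDeriv 5 h)) := by
  have hn0 : 0 < n := by omega
  have hp := PearsonChiSq.pos_of_one_le_mul hnp
  have key := PearsonChiSq.abs_walk_sub_integral_le hm hn0 hnp hp_sum hh (fun _ => rfl)
  rw [PearsonChiSq.integral_pearsonStat hp hp_sum hU]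
  refine key.trans ?_
  have hn' : (0 : ℝ) < n := by exact_mod_cast hn0
  have hs := fun k => PearsonChiSq.supNorm_nonneg (iteratedDeriv k h)
  have s0 := hs 0
  have s1 := hs 1
  have s2 := hs 2
  have s3 := hs 3
  have s4 := hs 4
  have s5 := hs 5
  rw [iteratedDeriv_zero] at s0
  rw [PearsonChiSq.sum_cellScale, div_pow, Real.sq_sqrt hn'.le, iteratedDeriv_zero]
  have e : ∀ x : ℝ, (∑ k, 1 / √(p k)) ^ 2 / n * (4 / ((m : ℝ) + 1) * x)
      = 4 / (((m : ℝ) + 1) * n) * (∑ j, 1 / √(p j)) ^ 2 * x := fun x => by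
    field_simp
  rw [e]
  refine mul_le_mul_of_nonneg_left ?_ (by positivity)
  -- The coefficients `12, 98, 708, 2014, 6200, 4800` obtained are dominated one by one by those
  -- claimed.
  linarith
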